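/- Let $(\mathbb{X},\mathcal{X})$ be a measurable space with a $\sigma$-finite measure $\mu$, and let ${\sf N}(\mathbb{X})$ be the space of $\sigma$-finite counting measures on $\mathbb{X}$ (that is, $\sigma$-finite measures with values in $\{0,1,2,\dots\}\cup\{\infty\}$), equipped with the smallest $\sigma$-field making all evaluations $\xi\mapsto\xi(B)$, $B\in\mathcal{X}$, measurable. Let $\eta$ be a Poisson process on $\mathbb{X}$ with intensity measure $\mu$, defined on a probability space $(\Omega,\mathcal{F},\mathbb{P})$: a measurable map $\eta:\Omega\to{\sf N}(\mathbb{X})$ such that $\eta(B)$ is Poisson distributed with mean $\mu(B)$ for every $B\in\mathcal{X}$ (almost surely equal to $\infty$ if $\mu(B)=\infty$), and such that $\eta(B_1),\dots,\eta(B_n)$ are independent for all $n$ and all pairwise disjoint $B_1,\dots,B_n\in\mathcal{X}$. Let $F$ be an integrable Poisson functional, i.e. a random variable with $\mathbb{E}|F|<\infty$ and $F=f(\eta)$ $\mathbb{P}$-almost surely for some measurable representative $f:{\sf N}(\mathbb{X})\to\mathbb{R}$. Assume that $F\ge 0$ $\mathbb{P}$-almost surely, and let $r\in(1,2)$. Put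 $$D_xF:=f(\eta+\delta_x)-f(\eta),\qquad D_xF^{\frac2r-1}:=f(\eta+\delta_x)^{\frac2r-1}-f(\eta)^{\frac2r-1},\qquad x\in\mathbb{X},$$ where $\delta_x$ is the Dirac measure at $x$, and let $$\operatorname{Ent}_r(F):=\mathbb{E}\big[F^{2/r}\big]-(\mathbb{E}[F])^{2/r}\in[0,\infty].$$ Then, for every representative $f$, the product $(D_xF)(D_xF^{\frac2r-1})$ is nonnegative for $\mu$-almost every $x$, $\mathbb{P}$-almost surely, and $$\operatorname{Ent}_r(F)\le\frac6r\,\mathbb{E}\Big[\int_{\mathbb{X}}(D_xF)\,\big(D_xF^{\frac2r-1}\big)\,\mu(\mathrm{d}x)\Big],$$ where both sides may be $+\infty$; in particular the right-hand side is $+\infty$ whenever $\mathbb{E}[F^{2/r}]=\infty$. -/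

import Mathlib

open MeasureTheory ProbabilityTheory
open scoped ENNReal NNReal

noncomputable section

/-- The space `N(X)` of sigma-finite counting measures on `X`: the sigma-finite measures that take
values in `{0, 1, 2, ...} ∪ {∞}` on measurable sets. As a subtype of `Measure X` it carries the
smallest sigma-field for which all evaluations `ξ ↦ ξ B`, `B` measurable, are measurable. -/
abbrev CountingMeasure (X : Type*) [MeasurableSpace X] : Type _ :=
  {ξ : Measure X // SigmaFinite ξ ∧ ∀ B, MeasurableSet B → ∃ n : ℕ∞, ξ B = (n : ℝ≥0∞)}

/-- The counting measure `ξ + δ_x`. -/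
def CountingMeasure.addDirac {X : Type*} [MeasurableSpace X] (ξ : CountingMeasure X) (x : X) :
    CountingMeasure X :=
  ⟨ξ.1 + Measure.dirac x, by
    have := ξ.2.1
    refine ⟨inferInstance, fun B hB => ?_⟩
    obtain ⟨n, hn⟩ := ξ.2.2 B hB
    by_cases hx : x ∈ B
    · exact ⟨n + 1, by simp [Measure.dirac_apply' x hB, hx, hn]⟩
    · exact ⟨n, by simp [Measure.dirac_apply' x hB, hx, hn]⟩⟩

/-- The Poisson distribution with mean `m ∈ [0, ∞]`, as a law on `[0, ∞]`;
with mean `∞` it is, as usual, the point mass at `∞`. -/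
def extPoissonLaw (m : ℝ≥0∞) : Measure ℝ≥0∞ :=
  open Classical in
  if m = ∞ then Measure.dirac ∞
  else (poissonMeasure m.toNNReal).map (fun k : ℕ => (k : ℝ≥0∞))

/-- `η` is a Poisson process on `X` with intensity measure `μ`, defined on `(Ω, P)`. -/
structure IsPoissonProcess {X Ω : Type*} [MeasurableSpace X] [MeasurableSpace Ω]
    (η : Ω → CountingMeasure X) (μ : Measure X) (P : Measure Ω) : Prop where
  measurable : Measurable η
  law : ∀ B, MeasurableSet B → P.map (fun ω => (η ω).1 B) = extPoissonLaw (μ B)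
  indep : ∀ (n : ℕ) (B : Fin n → Set X), (∀ i, MeasurableSet (B i)) →
    (∀ i j, i ≠ j → Disjoint (B i) (B j)) → iIndepFun (fun i ω => (η ω).1 (B i)) P

/-- `f` is a representative of the Poisson functional `F`: `f` is measurable
and `F = f(η)` almost surely. -/
def IsRepresentative {X Ω : Type*} [MeasurableSpace X] [MeasurableSpace Ω]
    (f : CountingMeasure X → ℝ) (F : Ω → ℝ) (η : Ω → CountingMeasure X) (P : Measure Ω) : Prop :=
  Measurable f ∧ ∀ᵐ ω ∂P, F ω = f (η ω)

/-- The difference operator, `(D_x f)(ξ) = f(ξ + δ_x) - f(ξ)`. If `f` represents `F`,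
then `D_x F` is `diffOp f x (η ω)`. -/
def diffOp {X : Type*} [MeasurableSpace X] (f : CountingMeasure X → ℝ) (x : X)
    (ξ : CountingMeasure X) : ℝ :=
  f (ξ.addDirac x) - f ξ

/-- The expectation `E[G] = E[G⁺] - E[G⁻]` with values in `[-∞, ∞]`, for real random variables `G`
for which `E[G⁺]` or `E[G⁻]` is finite. -/
def extExpectation {Ω : Type*} [MeasurableSpace Ω] (P : Measure Ω) (G : Ω → ℝ) : EReal :=
  ((∫⁻ ω, ENNReal.ofReal (G ω) ∂P : ℝ≥0∞) : EReal) -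
    ((∫⁻ ω, ENNReal.ofReal (-G ω) ∂P : ℝ≥0∞) : EReal)

/-- The `Φ`-entropy `E[Φ(F)] - Φ(E[F])` of an integrable random variable `F`; it may be `+∞`. -/
def phiEntropy {Ω : Type*} [MeasurableSpace Ω] (P : Measure Ω) (Φ : ℝ → ℝ) (F : Ω → ℝ) : EReal :=
  extExpectation P (fun ω => Φ (F ω)) - ((Φ (∫ ω, F ω ∂P) : ℝ) : EReal)

/-- The function `Φ_r(x) = x ^ (2 / r)` (used for `x ≥ 0`). -/
def powPhi (r : ℝ) (x : ℝ) : ℝ := x ^ (2 / r)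

end

/-! Put `p = 2 / r`, so `p` lies in `(1, 2)`, and let `powGap (p - 1) a b` be the integrand of the
right-hand side. Two facts about it carry the proof. First, for every constant `a` the `p`-entropy
of `g` is at most `p` times the mean of `powGap (p - 1) a g` (`ofReal_entropy_le`): add two
tangent-line inequalities and integrate. Second, `powGap q` is jointly convex for `0 ≤ q ≤ 1`
(`convexOn_powGap`), so by Jensen conditional expectations do not increase the jump energy.

On a set of finite intensity the Poisson process is a compound Poisson variable with values in the
monoid of counting measures, a jump being a unit point mass (`map_restrict`). Reveal its jumps along
`n + 1` equal time intervals. The entropy telescopes into conditional entropies of the increments.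
In an interval of length `s` there is no jump, or one jump with total weight at most `s • κ`, up to
`O(s ^ 2)`; comparing with the value without a jump bounds the increment by `p * s` times the jump
energy plus `O(s ^ 2)` (`condPowMean_step`). Letting `n` grow gives
`ofReal_entropy_compoundPoisson_le`.

For general `μ`, condition on the restrictions of the process to an exhausting sequence of sets of
finite intensity and use Lévy's upward theorem. This settles functionals with values in some `[e,
k]`, `e > 0`. For the rest, truncation does not increase `powGap`, and Fatou's lemma covers an
infinite `p`-th moment. The argument yields the constant `p = 2 / r`, which is smaller than `6 / r`.
-/

/-! ### Power inequalities: truncation, tangent lines and joint convexity -/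

/-- The symmetrised Bregman divergence `(b - a) (b ^ q - a ^ q)` of a power function. -/
noncomputable def powGap (q a b : ℝ) : ℝ := (b - a) * (b ^ q - a ^ q)

lemma powGap_comm (q a b : ℝ) : powGap q a b = powGap q b a := by
  unfold powGap; ring

lemma powGap_nonneg {q a b : ℝ} (hq : 0 ≤ q) (ha : 0 ≤ a) (hb : 0 ≤ b) : 0 ≤ powGap q a b := by
  unfold powGap
  rcases le_total a b with h | h
  · exact mul_nonneg (sub_nonneg.2 h) (sub_nonneg.2 (Real.rpow_le_rpow ha h hq))
  · exact mul_nonneg_of_nonpos_of_nonpos (sub_nonpos.2 h)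
      (sub_nonpos.2 (Real.rpow_le_rpow hb h hq))

lemma powGap_self (q a : ℝ) : powGap q a a = 0 := by simp [powGap]

lemma powGap_le {q a b K : ℝ} (hq : 0 ≤ q) (ha : 0 ≤ a) (hb : 0 ≤ b) (haK : a ≤ K)
    (hbK : b ≤ K) : powGap q a b ≤ K * K ^ q := by
  wlog h : a ≤ b generalizing a b
  · rw [powGap_comm]; exact this hb ha hbK haK (le_of_not_ge h)
  have h1 := Real.rpow_le_rpow hb hbK hq
  have h2 := Real.rpow_nonneg ha q
  have h3 := Real.rpow_le_rpow ha h hq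
  exact mul_le_mul (by linarith) (by linarith) (by linarith) (by linarith)

lemma measurable_powGap {α : Type*} [MeasurableSpace α] (q : ℝ) {f g : α → ℝ} (hf : Measurable f)
    (hg : Measurable g) : Measurable fun x => powGap q (f x) (g x) := by
  unfold powGap; fun_prop

/-- Truncation to `[e, k]`. -/
noncomputable def clamp (e k x : ℝ) : ℝ := max e (min x k)

lemma clamp_sub_clamp_le {e k x y : ℝ} (h : x ≤ y) : clamp e k y - clamp e k x ≤ y - x := by
  unfold clamp; grind

lemma clamp_mono {e k x y : ℝ} (h : x ≤ y) : clamp e k x ≤ clamp e k y :=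
  max_le_max le_rfl (min_le_min h le_rfl)

lemma clamp_rpow {e k x q : ℝ} (he : 0 ≤ e) (hk : 0 ≤ k) (hx : 0 ≤ x) (hq : 0 ≤ q) :
    clamp e k x ^ q = clamp (e ^ q) (k ^ q) (x ^ q) := by
  have hm : MonotoneOn (fun z : ℝ => z ^ q) (Set.Ici 0) := Real.monotoneOn_rpow_Ici_of_exponent_nonneg hq
  unfold clamp
  have h1 := hm.map_max he (show min x k ∈ Set.Ici 0 from le_min hx hk)
  have h2 := hm.map_min (show x ∈ Set.Ici 0 from hx) (show k ∈ Set.Ici 0 from hk)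
  rw [h1, h2]

/-- Clamping is monotone and 1-Lipschitz, and it commutes with `x ↦ x ^ q` up to changing the
thresholds, so both factors shrink without changing sign. -/
lemma powGap_clamp_le {e k a b q : ℝ} (he : 0 ≤ e) (hk : 0 ≤ k) (ha : 0 ≤ a) (hb : 0 ≤ b)
    (hq : 0 ≤ q) : powGap q (clamp e k a) (clamp e k b) ≤ powGap q a b := by
  wlog h : a ≤ b generalizing a b
  · rw [powGap_comm, powGap_comm q a]; exact this hb ha (le_of_not_ge h)
  unfold powGap
  rw [clamp_rpow he hk ha hq, clamp_rpow he hk hb hq]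
  have h3 := Real.rpow_le_rpow ha h hq
  exact mul_le_mul (clamp_sub_clamp_le h) (clamp_sub_clamp_le h3)
    (sub_nonneg.2 (clamp_mono h3)) (sub_nonneg.2 h)

/-- The tangent line inequality for `x ↦ x ^ p`. -/
lemma rpow_tangent_le {p x y : ℝ} (hp : 1 ≤ p) (hx : 0 ≤ x) (hy : 0 < y) :
    y ^ p + p * y ^ (p - 1) * (x - y) ≤ x ^ p := by
  have h := one_add_mul_self_le_rpow_one_add (s := x / y - 1) (by
    have := div_nonneg hx hy.le; linarith) hp
  have h2 : 1 + (x / y - 1) = x / y := by ring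
  rw [h2, Real.div_rpow hx hy.le, le_div_iff₀ (Real.rpow_pos_of_pos hy p)] at h
  have h3 : y ^ (p - 1) = y ^ p / y := by
    rw [Real.rpow_sub hy, Real.rpow_one]
  rw [h3]
  calc _ = (1 + p * (x / y - 1)) * y ^ p := by field_simp
    _ ≤ _ := h

/-- Sum of the tangent-line inequalities at `g` evaluated in `a` and at `a` evaluated in `c`. With
`c` the mean of `g`, the last term integrates to zero. -/
lemma rpow_sub_rpow_le {p a c g : ℝ} (hp : 1 ≤ p) (ha : 0 < a) (hg : 0 < g) (hc : 0 ≤ c) :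
    g ^ p - c ^ p ≤ p * powGap (p - 1) a g + p * a ^ (p - 1) * (g - c) := by
  have h1 := rpow_tangent_le hp ha.le hg
  have h2 := rpow_tangent_le hp hc ha
  unfold powGap
  nlinarith

/-- Cauchy–Schwarz, with the explicit slack `a * b * (v₁ * u₂ - v₂ * u₁) ^ 2 / (u₁ * u₂)`. The
inequality in `hw` leaves room for a concave function in the denominator. -/
lemma sq_div_convex {u₁ u₂ v₁ v₂ w a b : ℝ} (ha : 0 ≤ a) (hb : 0 ≤ b)
    (h1 : 0 < u₁) (h2 : 0 < u₂) (hw0 : 0 < w) (hw : a * u₁ + b * u₂ ≤ w) :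
    (a * v₁ + b * v₂) ^ 2 / w ≤ a * (v₁ ^ 2 / u₁) + b * (v₂ ^ 2 / u₂) := by
  rw [div_le_iff₀ hw0]
  have hS : 0 ≤ a * (v₁ ^ 2 / u₁) + b * (v₂ ^ 2 / u₂) := by positivity
  refine le_trans ?_ (mul_le_mul_of_nonneg_left hw hS)
  have : (a * (v₁ ^ 2 / u₁) + b * (v₂ ^ 2 / u₂)) * (a * u₁ + b * u₂) - (a * v₁ + b * v₂) ^ 2
      = a * b * (v₁ * u₂ - v₂ * u₁) ^ 2 / (u₁ * u₂) := by
    field_simp; ring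
  have h3 : 0 ≤ a * b * (v₁ * u₂ - v₂ * u₁) ^ 2 / (u₁ * u₂) := by positivity
  linarith

/-- The expression is `v ^ 2 / u ^ (1 - q)`: a square over a concave positive function. -/
lemma convexOn_sq_mul_rpow {q : ℝ} (hq0 : 0 ≤ q) (hq1 : q ≤ 1) {u₁ u₂ v₁ v₂ a b : ℝ}
    (ha : 0 ≤ a) (hb : 0 ≤ b) (hab : a + b = 1) (h1 : 0 < u₁) (h2 : 0 < u₂) :
    (a * v₁ + b * v₂) ^ 2 * (a * u₁ + b * u₂) ^ (q - 1) ≤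
      a * (v₁ ^ 2 * u₁ ^ (q - 1)) + b * (v₂ ^ 2 * u₂ ^ (q - 1)) := by
  have key : ∀ u : ℝ, 0 < u → u ^ (q - 1) = (u ^ (1 - q))⁻¹ := fun u hu => by
    rw [← Real.rpow_neg hu.le]; congr 1; ring
  have hu : 0 < a * u₁ + b * u₂ := by
    rcases ha.eq_or_lt with rfl | ha'
    · have : b = 1 := by linarith
      subst this; simpa
    · positivity
  rw [key _ h1, key _ h2, key _ hu, ← div_eq_mul_inv, ← div_eq_mul_inv, ← div_eq_mul_inv]
  refine sq_div_convex ha hb (by positivity) (by positivity) (by positivity) ?_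
  have hc := Real.concaveOn_rpow (p := 1 - q) (by linarith) (by linarith)
  exact hc.2 (x := u₁) (y := u₂) h1.le h2.le ha hb hab

lemma powGap_eq_integral {q a b : ℝ} (ha : 0 < a) (hb : 0 < b) :
    powGap q a b = q * ∫ s in (0:ℝ)..1, (b - a) ^ 2 * (a + s * (b - a)) ^ (q - 1) := by
  have hpos : ∀ s ∈ Set.uIcc (0:ℝ) 1, 0 < a + s * (b - a) := by
    intro s hs
    rw [Set.uIcc_of_le zero_le_one] at hs
    nlinarith [hs.1, hs.2, mul_nonneg hs.1 hb.le, mul_nonneg (sub_nonneg.2 hs.2) ha.le,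
      mul_pos ha hb]
  have hd : ∀ s ∈ Set.uIcc (0:ℝ) 1, HasDerivAt (fun s => (b - a) * (a + s * (b - a)) ^ q)
      (q * ((b - a) ^ 2 * (a + s * (b - a)) ^ (q - 1))) s := by
    intro s hs
    have h1 : HasDerivAt (fun s : ℝ => a + s * (b - a)) (b - a) s := by
      simpa using ((hasDerivAt_id s).mul_const (b - a)).const_add a
    refine ((h1.rpow_const (p := q) (Or.inl (hpos s hs).ne')).const_mul (b - a)).congr_deriv ?_
    ring
  have hi : IntervalIntegrable (fun s => q * ((b - a) ^ 2 * (a + s * (b - a)) ^ (q - 1)))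
      volume 0 1 := by
    apply ContinuousOn.intervalIntegrable
    refine continuousOn_const.mul (continuousOn_const.mul ?_)
    exact ContinuousOn.rpow_const (by fun_prop) fun s hs => Or.inl (hpos s hs).ne'
  rw [← intervalIntegral.integral_const_mul, intervalIntegral.integral_eq_sub_of_hasDerivAt hd hi]
  unfold powGap
  simp; ring

/-- By `powGap_eq_integral` the divergence is an average of the convex functions of
`convexOn_sq_mul_rpow`, with `u` and `v` linear in `(a, b)`. Staying above `e > 0` keeps the
negative power `q - 1` away from its singularity. -/
lemma convexOn_powGap {q e : ℝ} (hq0 : 0 ≤ q) (hq1 : q ≤ 1) (he : 0 < e) :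
    ConvexOn ℝ (Set.Ici e ×ˢ Set.Ici e) (fun z : ℝ × ℝ => powGap q z.1 z.2) := by
  refine ⟨(convex_Ici e).prod (convex_Ici e), ?_⟩
  rintro ⟨a₁, b₁⟩ ⟨ha₁, hb₁⟩ ⟨a₂, b₂⟩ ⟨ha₂, hb₂⟩ c d hc hd hcd
  simp only [Set.mem_Ici, Prod.smul_mk, smul_eq_mul, Prod.mk_add_mk] at *
  have hpos : ∀ a b : ℝ, e ≤ a → e ≤ b → ∀ s ∈ Set.Icc (0:ℝ) 1, 0 < a + s * (b - a) := by
    intro a b ha hb s hs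
    nlinarith [hs.1, hs.2, mul_nonneg hs.1 (sub_nonneg.2 hb),
      mul_nonneg (sub_nonneg.2 hs.2) (sub_nonneg.2 ha)]
  have hint : ∀ a b : ℝ, e ≤ a → e ≤ b → IntervalIntegrable
      (fun s => (b - a) ^ 2 * (a + s * (b - a)) ^ (q - 1)) volume 0 1 := by
    intro a b ha hb
    apply ContinuousOn.intervalIntegrable
    refine continuousOn_const.mul ?_
    refine ContinuousOn.rpow_const (by fun_prop) fun s hs => Or.inl (hpos a b ha hb s ?_).ne'
    rwa [Set.uIcc_of_le zero_le_one] at hs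
  have hcomb : ∀ x y : ℝ, e ≤ x → e ≤ y → e ≤ c * x + d * y := by
    intro x y hx hy
    nlinarith [mul_nonneg hc (sub_nonneg.2 hx), mul_nonneg hd (sub_nonneg.2 hy)]
  have hA := hcomb a₁ a₂ ha₁ ha₂
  have hB := hcomb b₁ b₂ hb₁ hb₂
  rw [powGap_eq_integral (he.trans_le hA) (he.trans_le hB),
    powGap_eq_integral (he.trans_le ha₁) (he.trans_le hb₁),
    powGap_eq_integral (he.trans_le ha₂) (he.trans_le hb₂)]
  have hle := intervalIntegral.integral_mono_on (zero_le_one (α := ℝ)) (hint _ _ hA hB)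
    (((hint _ _ ha₁ hb₁).const_mul c).add ((hint _ _ ha₂ hb₂).const_mul d)) (by
      intro s hs
      have := convexOn_sq_mul_rpow hq0 hq1 (v₁ := b₁ - a₁) (v₂ := b₂ - a₂) hc hd hcd
        (hpos a₁ b₁ ha₁ hb₁ s hs) (hpos a₂ b₂ ha₂ hb₂ s hs)
      have e1 : c * (b₁ - a₁) + d * (b₂ - a₂) = c * b₁ + d * b₂ - (c * a₁ + d * a₂) := by ring
      have e2 : c * (a₁ + s * (b₁ - a₁)) + d * (a₂ + s * (b₂ - a₂)) =
        c * a₁ + d * a₂ + s * (c * b₁ + d * b₂ - (c * a₁ + d * a₂)) := by ring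
      rw [e1, e2] at this
      exact this)
  rw [intervalIntegral.integral_add ((hint _ _ ha₁ hb₁).const_mul c)
    ((hint _ _ ha₂ hb₂).const_mul d), intervalIntegral.integral_const_mul c,
    intervalIntegral.integral_const_mul d] at hle
  have := mul_le_mul_of_nonneg_left hle hq0
  linarith

lemma continuousOn_powGap {q e : ℝ} (he : 0 < e) :
    ContinuousOn (fun z : ℝ × ℝ => powGap q z.1 z.2) (Set.Ici e ×ˢ Set.Ici e) := by
  unfold powGap
  refine ContinuousOn.mul (by fun_prop) (ContinuousOn.sub ?_ ?_)
  · exact ContinuousOn.rpow_const (by fun_prop) fun z hz => Or.inl (he.trans_le hz.2).ne'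
  · exact ContinuousOn.rpow_const (by fun_prop) fun z hz => Or.inl (he.trans_le hz.1).ne'

/-! ### Jensen's inequality and the entropy bound for bounded random variables -/

section
variable {α : Type*} [MeasurableSpace α] {Q : Measure α}

lemma integrable_of_mem_Icc [IsFiniteMeasure Q] {f : α → ℝ} (hf : Measurable f) {e k : ℝ}
    (h : ∀ x, f x ∈ Set.Icc e k) : Integrable f Q :=
  Integrable.of_bound hf.aestronglyMeasurable (max |e| |k|)
    (.of_forall fun x => abs_le_max_abs_abs (h x).1 (h x).2)

lemma integral_mem_Icc [IsProbabilityMeasure Q] {f : α → ℝ} (hf : Measurable f) {e k : ℝ}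
    (h : ∀ x, f x ∈ Set.Icc e k) : ∫ x, f x ∂Q ∈ Set.Icc e k := by
  have hi := integrable_of_mem_Icc (Q := Q) hf h
  constructor
  · simpa using integral_mono (integrable_const e) hi fun x => (h x).1
  · simpa using integral_mono hi (integrable_const k) fun x => (h x).2

lemma integrable_powGap [IsFiniteMeasure Q] {q e k : ℝ} (hq : 0 ≤ q) (he : 0 < e) {f g : α → ℝ}
    (hf : Measurable f) (hg : Measurable g) (hfm : ∀ x, f x ∈ Set.Icc e k)
    (hgm : ∀ x, g x ∈ Set.Icc e k) : Integrable (fun x => powGap q (f x) (g x)) Q :=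
  integrable_of_mem_Icc (measurable_powGap q hf hg) (e := 0) (k := k * k ^ q) fun x =>
    ⟨powGap_nonneg hq (he.le.trans (hfm x).1) (he.le.trans (hgm x).1),
      powGap_le hq (he.le.trans (hfm x).1) (he.le.trans (hgm x).1) (hfm x).2 (hgm x).2⟩

/-- Jensen's inequality for the jointly convex function `powGap q`. -/
lemma ofReal_powGap_integral_le [IsProbabilityMeasure Q] {q e k : ℝ} (hq0 : 0 ≤ q) (hq1 : q ≤ 1)
    (he : 0 < e) {f g : α → ℝ} (hf : Measurable f) (hg : Measurable g)
    (hfm : ∀ x, f x ∈ Set.Icc e k) (hgm : ∀ x, g x ∈ Set.Icc e k) :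
    ENNReal.ofReal (powGap q (∫ x, f x ∂Q) (∫ x, g x ∂Q)) ≤
      ∫⁻ x, ENNReal.ofReal (powGap q (f x) (g x)) ∂Q := by
  have hi := integrable_powGap (Q := Q) hq0 he hf hg hfm hgm
  have hif := integrable_of_mem_Icc (Q := Q) hf hfm
  have hig := integrable_of_mem_Icc (Q := Q) hg hgm
  have h := (convexOn_powGap hq0 hq1 he).map_integral_le (μ := Q) (f := fun x => (f x, g x))
    (continuousOn_powGap he) (isClosed_Ici.prod isClosed_Ici)
    (.of_forall fun x => ⟨(hfm x).1, (hgm x).1⟩) (hif.prodMk hig) hi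
  rw [integral_pair hif hig] at h
  rw [← ofReal_integral_eq_lintegral_ofReal hi (.of_forall fun x =>
    powGap_nonneg hq0 (he.le.trans (hfm x).1) (he.le.trans (hgm x).1))]
  exact ENNReal.ofReal_le_ofReal h

lemma rpow_mem_Icc {p e k x : ℝ} (hp : 0 ≤ p) (he : 0 < e) (h : x ∈ Set.Icc e k) :
    x ^ p ∈ Set.Icc (e ^ p) (k ^ p) :=
  ⟨Real.rpow_le_rpow he.le h.1 hp, Real.rpow_le_rpow (he.le.trans h.1) h.2 hp⟩

/-- The entropy of a bounded random variable is at most its mean divergence from a constant. -/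
lemma ofReal_entropy_le [IsProbabilityMeasure Q] {p e k a : ℝ} (hp : 1 ≤ p) (he : 0 < e)
    {g : α → ℝ} (hg : Measurable g) (hgm : ∀ x, g x ∈ Set.Icc e k) (ha : a ∈ Set.Icc e k) :
    ENNReal.ofReal (∫ x, g x ^ p ∂Q - (∫ x, g x ∂Q) ^ p) ≤
      ENNReal.ofReal p * ∫⁻ x, ENNReal.ofReal (powGap (p - 1) a (g x)) ∂Q := by
  have hq : 0 ≤ p - 1 := by linarith
  have hi := integrable_powGap (Q := Q) hq he measurable_const hg (fun _ => ha) hgm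
  have hig := integrable_of_mem_Icc (Q := Q) hg hgm
  have hip := integrable_of_mem_Icc (Q := Q) (hg.pow_const p)
    fun x => rpow_mem_Icc (by linarith) he (hgm x)
  have hE := integral_mem_Icc (Q := Q) hg hgm
  rw [← ofReal_integral_eq_lintegral_ofReal hi (.of_forall fun x =>
    powGap_nonneg hq (he.le.trans ha.1) (he.le.trans (hgm x).1)), ← ENNReal.ofReal_mul (by linarith)]
  refine ENNReal.ofReal_le_ofReal ?_
  have hi1 : Integrable (fun x => p * powGap (p - 1) a (g x)) Q := hi.const_mul p
  have hi2 : Integrable (fun x => g x - ∫ x, g x ∂Q) Q := hig.sub (integrable_const _)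
  have hi3 : Integrable (fun x => p * a ^ (p - 1) * (g x - ∫ x, g x ∂Q)) Q := hi2.const_mul _
  have h := integral_mono (μ := Q) (f := fun x => g x ^ p - (∫ x, g x ∂Q) ^ p)
    (g := fun x => p * powGap (p - 1) a (g x) + p * a ^ (p - 1) * (g x - ∫ x, g x ∂Q))
    (hip.sub (integrable_const _))
    (hi1.add hi3) fun x =>
      rpow_sub_rpow_le hp (he.trans_le ha.1) (he.trans_le (hgm x).1) (he.le.trans hE.1)
  rw [integral_sub hip (integrable_const _), integral_add hi1 hi3,
    integral_const_mul, integral_const_mul,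
    integral_sub hig (integrable_const _)] at h
  simpa using h

end

/-! ### Compound Poisson laws on a measurable commutative monoid -/

section CompoundPoisson
open scoped Nat
variable {M : Type*} [MeasurableSpace M]

/-- The weight of `k` jumps in the compound Poisson law with jump measure `s • κ`,
divided by the `k`-th power of the mass of `κ`. -/
noncomputable def jumpWeight (κ : Measure M) (s : ℝ≥0) (k : ℕ) : ℝ≥0∞ :=
  ENNReal.ofReal (Real.exp (-(s * κ.real Set.univ)) * s ^ k / k !)

lemma jumpWeight_mul_pow (κ : Measure M) [IsFiniteMeasure κ] (s : ℝ≥0) (k : ℕ) :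
    jumpWeight κ s k * κ Set.univ ^ k = poissonMeasure (s * (κ Set.univ).toNNReal) {k} := by
  have h : κ Set.univ = ENNReal.ofReal (κ.real Set.univ) := (ofReal_measureReal).symm
  rw [poissonMeasure_singleton, jumpWeight]
  conv_lhs => rw [h]
  rw [← ENNReal.ofReal_pow measureReal_nonneg, ← ENNReal.ofReal_mul (by positivity)]
  congr 1
  push_cast
  rw [← measureReal_def]
  ring

/-- The binomial theorem; it is the source of the semigroup property in `s`. -/
lemma jumpWeight_antidiagonal (κ : Measure M) (s t : ℝ≥0) (n : ℕ) :
    ∑ ij ∈ Finset.HasAntidiagonal.antidiagonal n, jumpWeight κ s ij.1 * jumpWeight κ t ij.2 =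
      jumpWeight κ (s + t) n := by
  unfold jumpWeight
  rw [Finset.sum_congr rfl fun ij _ => (ENNReal.ofReal_mul (by positivity)).symm,
    ← ENNReal.ofReal_sum_of_nonneg fun _ _ => by positivity]
  congr 1
  push_cast
  rw [(Commute.all (s : ℝ) t).add_pow', Finset.mul_sum, Finset.sum_div]
  refine Finset.sum_congr rfl fun ij hij => ?_
  obtain rfl := Finset.HasAntidiagonal.mem_antidiagonal.1 hij
  rw [add_mul, neg_add, Real.exp_add, nsmul_eq_mul, Nat.cast_add_choose]
  field_simp

variable [AddCommMonoid M]

/-- Powers of a measure with respect to additive convolution. -/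
noncomputable def convPow (κ : Measure M) : ℕ → Measure M
  | 0 => Measure.dirac 0
  | k + 1 => κ ∗ convPow κ k

instance isFiniteMeasure_convPow (κ : Measure M) [IsFiniteMeasure κ] (k : ℕ) :
    IsFiniteMeasure (convPow κ k) := by
  induction k with
  | zero => exact inferInstanceAs (IsFiniteMeasure (Measure.dirac 0))
  | succ k ih => exact inferInstanceAs (IsFiniteMeasure (κ ∗ convPow κ k))

/-- The compound Poisson law with jump measure `s • κ`. -/
noncomputable def compoundPoisson (κ : Measure M) (s : ℝ≥0) : Measure M :=
  Measure.sum fun k => jumpWeight κ s k • convPow κ k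

lemma lintegral_compoundPoisson (κ : Measure M) (s : ℝ≥0) (G : M → ℝ≥0∞) :
    ∫⁻ x, G x ∂compoundPoisson κ s = ∑' k, jumpWeight κ s k * ∫⁻ x, G x ∂convPow κ k := by
  simp [compoundPoisson, lintegral_sum_measure, lintegral_smul_measure]

lemma compoundPoisson_zero (κ : Measure M) [IsFiniteMeasure κ] :
    compoundPoisson κ 0 = Measure.dirac 0 := by
  refine Measure.ext_of_lintegral _ fun G hG => ?_
  rw [lintegral_compoundPoisson, tsum_eq_single 0]
  · simp [jumpWeight, convPow]
  · intro k hk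
    simp [jumpWeight, hk]

variable [MeasurableAdd₂ M]

lemma convPow_univ (κ : Measure M) [IsFiniteMeasure κ] (k : ℕ) :
    convPow κ k Set.univ = κ Set.univ ^ k := by
  induction k with
  | zero => simp [convPow]
  | succ k ih =>
    rw [← lintegral_one, convPow, Measure.lintegral_conv measurable_const]
    simp [ih, pow_succ, mul_comm]

lemma convPow_add (κ : Measure M) [IsFiniteMeasure κ] (i j : ℕ) :
    convPow κ (i + j) = convPow κ i ∗ convPow κ j := by
  induction i with
  | zero => simp [convPow]
  | succ i ih => rw [Nat.succ_add, convPow, ih, convPow, Measure.conv_assoc]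

lemma convPow_one (κ : Measure M) [IsFiniteMeasure κ] : convPow κ 1 = κ := by
  simp [convPow]

instance isProbabilityMeasure_compoundPoisson (κ : Measure M) [IsFiniteMeasure κ] (s : ℝ≥0) :
    IsProbabilityMeasure (compoundPoisson κ s) := by
  constructor
  rw [← lintegral_one, lintegral_compoundPoisson]
  simp only [lintegral_one, convPow_univ, jumpWeight_mul_pow]
  have := measure_univ (μ := poissonMeasure (s * (κ Set.univ).toNNReal))
  rw [← Set.iUnion_of_singleton ℕ, measure_iUnion (by
    intro i j hij; simpa using hij) fun i => measurableSet_singleton i] at this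
  exact this

lemma tsum_mul_tsum_antidiagonal (a b c : ℕ → ℝ≥0∞) :
    ∑' i, a i * ∑' j, b j * c (i + j) =
      ∑' n, (∑ ij ∈ Finset.HasAntidiagonal.antidiagonal n, a ij.1 * b ij.2) * c n := by
  simp_rw [← ENNReal.tsum_mul_left]
  rw [← ENNReal.tsum_prod (f := fun i j => a i * (b j * c (i + j))),
    ← Finset.HasAntidiagonal.sigmaAntidiagonalEquivProd.tsum_eq, ENNReal.tsum_sigma']
  refine tsum_congr fun n => ?_
  rw [tsum_fintype, Finset.sum_mul,
    ← Finset.sum_coe_sort (Finset.HasAntidiagonal.antidiagonal n) fun ij => a ij.1 * b ij.2 * c n]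
  refine Finset.sum_congr rfl fun ij _ => ?_
  simp [Finset.HasAntidiagonal.sigmaAntidiagonalEquivProd, Finset.HasAntidiagonal.mem_antidiagonal.1 ij.2, mul_assoc]

lemma lintegral_compoundPoisson_add (κ : Measure M) [IsFiniteMeasure κ] (s t : ℝ≥0)
    {G : M → ℝ≥0∞} (hG : Measurable G) :
    ∫⁻ x, G x ∂compoundPoisson κ (s + t) =
      ∫⁻ x, ∫⁻ y, G (x + y) ∂compoundPoisson κ t ∂compoundPoisson κ s := by
  simp_rw [lintegral_compoundPoisson, ← jumpWeight_antidiagonal]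
  rw [← tsum_mul_tsum_antidiagonal]
  refine tsum_congr fun i => ?_
  congr 1
  rw [lintegral_tsum fun j => by
    refine Measurable.aemeasurable (Measurable.const_mul ?_ _)
    exact Measurable.lintegral_prod_right' (f := fun z : M × M => G (z.1 + z.2)) (by fun_prop)]
  refine tsum_congr fun j => ?_
  rw [lintegral_const_mul _ (Measurable.lintegral_prod_right'
    (f := fun z : M × M => G (z.1 + z.2)) (by fun_prop)), convPow_add, Measure.lintegral_conv hG]

lemma conv_compoundPoisson (κ : Measure M) [IsFiniteMeasure κ] (s t : ℝ≥0) :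
    compoundPoisson κ s ∗ compoundPoisson κ t = compoundPoisson κ (s + t) :=
  Measure.ext_of_lintegral _ fun G hG => by
    rw [Measure.lintegral_conv hG, lintegral_compoundPoisson_add κ s t hG]

/-- During the additional time `s` there is no jump with probability `exp (-s * m)`, where `m` is
the mass of `κ`; keep only that term. -/
lemma lintegral_compoundPoisson_le (κ : Measure M) [IsFiniteMeasure κ] (s t : ℝ≥0)
    {G : M → ℝ≥0∞} (hG : Measurable G) :
    ∫⁻ x, G x ∂compoundPoisson κ t ≤
      ENNReal.ofReal (Real.exp (s * κ.real Set.univ)) * ∫⁻ x, G x ∂compoundPoisson κ (s + t) := by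
  rw [lintegral_compoundPoisson_add κ s t hG, lintegral_compoundPoisson κ s]
  calc ∫⁻ x, G x ∂compoundPoisson κ t
      = ENNReal.ofReal (Real.exp (s * κ.real Set.univ)) *
        (jumpWeight κ s 0 * ∫⁻ x, ∫⁻ y, G (x + y) ∂compoundPoisson κ t ∂convPow κ 0) := by
        have hm : Measurable fun x => ∫⁻ y, G (x + y) ∂compoundPoisson κ t :=
          Measurable.lintegral_prod_right' (f := fun z : M × M => G (z.1 + z.2)) (by fun_prop)
        rw [convPow, lintegral_dirac' _ hm, ← mul_assoc, jumpWeight,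
          ← ENNReal.ofReal_mul (by positivity)]
        simp [← Real.exp_add]
    _ ≤ _ := by
        gcongr
        exact ENNReal.le_tsum (f := fun k => jumpWeight κ s k *
          ∫⁻ x, ∫⁻ y, G (x + y) ∂compoundPoisson κ t ∂convPow κ k) 0

/-- Up to an error of order two, at most one jump occurs in a short time. -/
lemma lintegral_compoundPoisson_small (κ : Measure M) [IsFiniteMeasure κ] (s : ℝ≥0)
    {H : M → ℝ≥0∞} (hH : Measurable H) (hH0 : H 0 = 0) {C : ℝ≥0∞} (hC : ∀ x, H x ≤ C) :
    ∫⁻ x, H x ∂compoundPoisson κ s ≤ s * ∫⁻ x, H x ∂κ + (s * κ Set.univ) ^ 2 * C := by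
  set m := κ Set.univ
  have hb : ∀ k, ∫⁻ x, H x ∂convPow κ k ≤ m ^ k * C := fun k => by
    calc _ ≤ ∫⁻ x, C ∂convPow κ k := lintegral_mono hC
      _ = _ := by rw [lintegral_const, convPow_univ, mul_comm]
  -- Two jumps cost a factor `s ^ 2`; what remains sums to the total mass of the compound Poisson
  -- law.
  have hw : ∀ k, jumpWeight κ s (k + 2) ≤ s ^ 2 * jumpWeight κ s k := fun k => by
    unfold jumpWeight
    have : (s : ℝ≥0∞) ^ 2 = ENNReal.ofReal ((s : ℝ) ^ 2) := by
      rw [ENNReal.ofReal_pow (by positivity)]; simp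
    rw [this, ← ENNReal.ofReal_mul (by positivity)]
    refine ENNReal.ofReal_le_ofReal ?_
    rw [pow_add, ← mul_assoc, mul_comm _ ((s : ℝ) ^ 2), mul_div_assoc]
    gcongr
    omega
  have h1 : jumpWeight κ s 1 ≤ s := by
    unfold jumpWeight
    calc _ ≤ ENNReal.ofReal s := by
          refine ENNReal.ofReal_le_ofReal ?_
          have : Real.exp (-(s * κ.real Set.univ)) ≤ 1 := by
            rw [Real.exp_le_one_iff]; simp; positivity
          simpa using mul_le_mul_of_nonneg_right this s.2
      _ = _ := by simp
  rw [lintegral_compoundPoisson, tsum_eq_zero_add' ENNReal.summable,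
    tsum_eq_zero_add' ENNReal.summable]
  have h0 : ∫⁻ x, H x ∂convPow κ 0 = 0 := by simp [convPow, lintegral_dirac' _ hH, hH0]
  rw [h0, mul_zero, zero_add, zero_add, convPow_one]
  gcongr
  calc ∑' k, jumpWeight κ s (k + 1 + 1) * ∫⁻ x, H x ∂convPow κ (k + 1 + 1)
      ≤ ∑' k, (s * m) ^ 2 * C * (jumpWeight κ s k * m ^ k) := by
        refine ENNReal.tsum_le_tsum fun k => ?_
        calc _ ≤ (s ^ 2 * jumpWeight κ s k) * (m ^ (k + 2) * C) := mul_le_mul' (hw k) (hb _)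
          _ = _ := by ring
    _ = (s * m) ^ 2 * C * ∑' k, jumpWeight κ s k * ∫⁻ x, 1 ∂convPow κ k := by
        rw [ENNReal.tsum_mul_left]; simp [convPow_univ, m]
    _ = (s * m) ^ 2 * C := by
        rw [← lintegral_compoundPoisson]; simp

/-- Since `s > 0`, all weights are positive, so a null set is null for every convolution power of
`κ`; one more jump only raises the power by one. -/
lemma conv_compoundPoisson_absolutelyContinuous (κ : Measure M) [IsFiniteMeasure κ] {s : ℝ≥0}
    (hs : 0 < s) : κ ∗ compoundPoisson κ s ≪ compoundPoisson κ s := by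
  refine Measure.AbsolutelyContinuous.mk fun S hS h => ?_
  have hG : Measurable (S.indicator (1 : M → ℝ≥0∞)) := measurable_one.indicator hS
  rw [← lintegral_indicator_one hS, lintegral_compoundPoisson, ENNReal.tsum_eq_zero] at h
  have hz : ∀ k, ∫⁻ x, S.indicator 1 x ∂convPow κ k = 0 := fun k => by
    refine (mul_eq_zero.1 (h k)).resolve_left ?_
    rw [jumpWeight, ENNReal.ofReal_eq_zero, not_le]
    positivity
  rw [← lintegral_indicator_one hS, Measure.lintegral_conv hG]
  simp_rw [lintegral_compoundPoisson]
  rw [lintegral_tsum fun j => by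
    refine Measurable.aemeasurable (Measurable.const_mul ?_ _)
    exact Measurable.lintegral_prod_right'
      (f := fun z : M × M => S.indicator 1 (z.1 + z.2)) (by fun_prop)]
  refine ENNReal.tsum_eq_zero.2 fun k => ?_
  rw [lintegral_const_mul _ (Measurable.lintegral_prod_right'
    (f := fun z : M × M => S.indicator 1 (z.1 + z.2)) (by fun_prop)),
    ← Measure.lintegral_conv hG, ← convPow, hz, mul_zero]

lemma map_convPow {M' : Type*} [AddCommMonoid M'] [MeasurableSpace M'] [MeasurableAdd₂ M']
    (κ : Measure M) [IsFiniteMeasure κ] (L : M →+ M') (hL : Measurable L) (k : ℕ) :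
    (convPow κ k).map L = convPow (κ.map L) k := by
  induction k with
  | zero => simp [convPow, Measure.map_dirac' hL]
  | succ k ih => rw [convPow, Measure.map_conv_addMonoidHom L hL, ih, convPow]

lemma map_compoundPoisson {M' : Type*} [AddCommMonoid M'] [MeasurableSpace M'] [MeasurableAdd₂ M']
    (κ : Measure M) [IsFiniteMeasure κ] (L : M →+ M') (hL : Measurable L) (s : ℝ≥0) :
    (compoundPoisson κ s).map L = compoundPoisson (κ.map L) s := by
  refine Measure.ext_of_lintegral _ fun G hG => ?_
  have hw : jumpWeight (κ.map L) s = jumpWeight κ s := by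
    ext k
    rw [jumpWeight, jumpWeight, map_measureReal_apply hL MeasurableSet.univ, Set.preimage_univ]
  rw [lintegral_map hG hL, lintegral_compoundPoisson, lintegral_compoundPoisson, hw]
  refine tsum_congr fun k => ?_
  rw [← map_convPow κ L hL, lintegral_map hG hL]

end CompoundPoisson

/-! ### The entropy inequality for compound Poisson laws -/

section FiniteEntropy

lemma ofReal_integral_le_lintegral {α : Type*} [MeasurableSpace α] {Q : Measure α} {h : α → ℝ}
    (hi : Integrable h Q) :
    ENNReal.ofReal (∫ x, h x ∂Q) ≤ ∫⁻ x, ENNReal.ofReal (h x) ∂Q := by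
  rw [integral_eq_lintegral_pos_part_sub_lintegral_neg_part hi]
  refine (ENNReal.ofReal_le_ofReal (sub_le_self _ ENNReal.toReal_nonneg)).trans ?_
  exact ENNReal.ofReal_toReal_le

variable {M : Type*} [AddCommMonoid M] [MeasurableSpace M] [MeasurableAdd₂ M]

lemma measurable_integral_add (Q : Measure M) [SFinite Q] {f : M → ℝ} (hf : Measurable f) :
    Measurable fun x => ∫ y, f (x + y) ∂Q :=
  (StronglyMeasurable.integral_prod_right' (f := fun z : M × M => f (z.1 + z.2))
    (by fun_prop : Measurable fun z : M × M => f (z.1 + z.2)).stronglyMeasurable).measurable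

lemma integral_add_mem_Icc (Q : Measure M) [IsProbabilityMeasure Q] {f : M → ℝ}
    (hf : Measurable f) {e k : ℝ} (hfm : ∀ x, f x ∈ Set.Icc e k) (x : M) :
    ∫ y, f (x + y) ∂Q ∈ Set.Icc e k :=
  integral_mem_Icc (by fun_prop) fun y => hfm (x + y)

lemma measurable_lintegral_powGap_add (κ : Measure M) [SFinite κ] (q : ℝ) {f : M → ℝ}
    (hf : Measurable f) :
    Measurable fun x => ∫⁻ z, ENNReal.ofReal (powGap q (f x) (f (x + z))) ∂κ :=
  Measurable.lintegral_prod_right'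
    (f := fun w : M × M => ENNReal.ofReal (powGap q (f w.1) (f (w.1 + w.2))))
    (measurable_powGap q (by fun_prop) (by fun_prop)).ennreal_ofReal

/-- Averaging over an independent summand decreases the jump energy. -/
lemma lintegral_powGap_integral_add_le (κ Q : Measure M) [SFinite κ] [IsProbabilityMeasure Q]
    {q e k : ℝ} (hq0 : 0 ≤ q) (hq1 : q ≤ 1) (he : 0 < e) {f : M → ℝ} (hf : Measurable f)
    (hfm : ∀ x, f x ∈ Set.Icc e k) (x : M) :
    ∫⁻ z, ENNReal.ofReal (powGap q (∫ y, f (x + y) ∂Q) (∫ y, f (x + z + y) ∂Q)) ∂κ ≤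
      ∫⁻ y, ∫⁻ z, ENNReal.ofReal (powGap q (f (x + y)) (f (x + y + z))) ∂κ ∂Q := by
  calc _ ≤ ∫⁻ z, ∫⁻ y, ENNReal.ofReal (powGap q (f (x + y)) (f (x + z + y))) ∂Q ∂κ :=
        lintegral_mono fun z => ofReal_powGap_integral_le hq0 hq1 he (by fun_prop) (by fun_prop)
          (fun y => hfm _) fun y => hfm _
    _ = _ := by
        rw [lintegral_lintegral_swap (Measurable.aemeasurable
          (measurable_powGap q (by fun_prop) (by fun_prop)).ennreal_ofReal)]
        refine lintegral_congr fun y => lintegral_congr fun z => ?_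
        rw [add_right_comm]

/-- The mean of `Φ` of the conditional expectation of `f` given the jumps up to time `t`,
where jumps occur until time `t + u`. -/
noncomputable def condPowMean (κ : Measure M) (p : ℝ) (f : M → ℝ) (t u : ℝ≥0) : ℝ :=
  ∫ x, (∫ y, f (x + y) ∂compoundPoisson κ u) ^ p ∂compoundPoisson κ t

variable (κ : Measure M) [IsFiniteMeasure κ]

lemma integral_compoundPoisson_add (s t : ℝ≥0) {f : M → ℝ}
    (hf : Integrable f (compoundPoisson κ (s + t))) :
    ∫ x, f x ∂compoundPoisson κ (s + t) =
      ∫ x, ∫ y, f (x + y) ∂compoundPoisson κ t ∂compoundPoisson κ s := by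
  rw [← conv_compoundPoisson] at hf ⊢
  exact integral_conv hf

/-- With the last `u` units of time averaged out, giving a function `g`, the increment is the mean
over the past of the entropy of `g` under the jumps of an interval of length `s`. -/
lemma condPowMean_step {p e k : ℝ} (hp1 : 1 ≤ p) (hp2 : p ≤ 2) (he : 0 < e) {f : M → ℝ}
    (hf : Measurable f) (hfm : ∀ x, f x ∈ Set.Icc e k) (s t u : ℝ≥0) :
    ENNReal.ofReal (condPowMean κ p f (t + s) u - condPowMean κ p f t (s + u)) ≤
      ENNReal.ofReal p * (s * (ENNReal.ofReal (Real.exp (s * κ.real Set.univ)) *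
        ∫⁻ x, ∫⁻ z, ENNReal.ofReal (powGap (p - 1) (f x) (f (x + z))) ∂κ
          ∂compoundPoisson κ (s + (t + u))) +
        (s * κ Set.univ) ^ 2 * ENNReal.ofReal (k * k ^ (p - 1))) := by
  have hq0 : 0 ≤ p - 1 := by linarith
  have hq1 : p - 1 ≤ 1 := by linarith
  set g : M → ℝ := fun x => ∫ y, f (x + y) ∂compoundPoisson κ u with hg_def
  have hg : Measurable g := measurable_integral_add _ hf
  have hgm : ∀ x, g x ∈ Set.Icc e k := integral_add_mem_Icc _ hf hfm
  have hgp : Measurable fun x => g x ^ p := hg.pow_const p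
  have hgpm : ∀ x, g x ^ p ∈ Set.Icc (e ^ p) (k ^ p) := fun x =>
    rpow_mem_Icc (by linarith) he (hgm x)
  have hA : Measurable fun x => ∫ z, g (x + z) ^ p ∂compoundPoisson κ s :=
    measurable_integral_add _ hgp
  have hB : Measurable fun x => (∫ z, g (x + z) ∂compoundPoisson κ s) ^ p :=
    (measurable_integral_add _ hg).pow_const p
  have hAi := integrable_of_mem_Icc (Q := compoundPoisson κ t) hA
    (integral_add_mem_Icc _ hgp hgpm)
  have hBi := integrable_of_mem_Icc (Q := compoundPoisson κ t) hB
    fun x => rpow_mem_Icc (by linarith) he (integral_add_mem_Icc _ hg hgm x)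
  have e1 : condPowMean κ p f (t + s) u =
      ∫ x, ∫ z, g (x + z) ^ p ∂compoundPoisson κ s ∂compoundPoisson κ t :=
    integral_compoundPoisson_add κ t s (integrable_of_mem_Icc hgp hgpm)
  have e2 : condPowMean κ p f t (s + u) =
      ∫ x, (∫ z, g (x + z) ∂compoundPoisson κ s) ^ p ∂compoundPoisson κ t := by
    unfold condPowMean
    congr 1; ext x; congr 1
    rw [integral_compoundPoisson_add κ s u
      (integrable_of_mem_Icc (by fun_prop) fun y => hfm (x + y))]
    simp only [hg_def, add_assoc]
  rw [e1, e2, ← integral_sub hAi hBi]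
  refine (ofReal_integral_le_lintegral (hAi.sub hBi)).trans ?_
  set β : M → ℝ≥0∞ := fun x => ∫⁻ z, ENNReal.ofReal (powGap (p - 1) (f x) (f (x + z))) ∂κ
  have hβ : Measurable β := measurable_lintegral_powGap_add κ (p - 1) hf
  set C := ENNReal.ofReal (k * k ^ (p - 1))
  have hγ : Measurable fun x => ∫⁻ y, β (x + y) ∂compoundPoisson κ u :=
    Measurable.lintegral_prod_right' (f := fun z : M × M => β (z.1 + z.2)) (by fun_prop)
  have hpt : ∀ x, ENNReal.ofReal (∫ z, g (x + z) ^ p ∂compoundPoisson κ s -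
      (∫ z, g (x + z) ∂compoundPoisson κ s) ^ p) ≤
      ENNReal.ofReal p * (s * ∫⁻ y, β (x + y) ∂compoundPoisson κ u +
        (s * κ Set.univ) ^ 2 * C) := by
    intro x
    -- The constant `g x` is the value without a jump. The divergence then vanishes at `0`, as
    -- `lintegral_compoundPoisson_small` requires, so the bound is of first order in `s`.
    refine (ofReal_entropy_le (Q := compoundPoisson κ s) (a := g x) hp1 he (by fun_prop) (fun z => hgm (x + z))
      (hgm x)).trans ?_
    gcongr
    refine (lintegral_compoundPoisson_small κ s
      (H := fun z => ENNReal.ofReal (powGap (p - 1) (g x) (g (x + z))))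
      (measurable_powGap _ (by fun_prop) (by fun_prop)).ennreal_ofReal (by simp [powGap_self])
      (C := C) fun z => ENNReal.ofReal_le_ofReal (powGap_le hq0 (he.le.trans (hgm x).1)
        (he.le.trans (hgm _).1) (hgm x).2 (hgm _).2)).trans ?_
    refine add_le_add (mul_le_mul_right ?_ _) le_rfl
    exact lintegral_powGap_integral_add_le κ (compoundPoisson κ u) hq0 hq1 he hf hfm x
  refine (lintegral_mono hpt).trans ?_
  rw [lintegral_const_mul _ (by fun_prop), lintegral_add_right _ measurable_const,
    lintegral_const_mul _ hγ, lintegral_const, measure_univ (μ := compoundPoisson κ t),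
    mul_one,
    ← lintegral_compoundPoisson_add κ t u hβ]
  gcongr
  -- The energy appears at time `t + u`. Passing to `s + (t + u)` costs a factor close to 1 and
  -- gives every step of the subdivision the same energy at time 1.
  exact lintegral_compoundPoisson_le κ s (t + u) hβ

/-- The entropy inequality for bounded functionals of a compound Poisson variable. -/
theorem ofReal_entropy_compoundPoisson_le {p e k : ℝ} (hp1 : 1 ≤ p) (hp2 : p ≤ 2) (he : 0 < e)
    {f : M → ℝ} (hf : Measurable f) (hfm : ∀ x, f x ∈ Set.Icc e k) :
    ENNReal.ofReal (∫ x, f x ^ p ∂compoundPoisson κ 1 - (∫ x, f x ∂compoundPoisson κ 1) ^ p) ≤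
      ENNReal.ofReal p * ∫⁻ x, ∫⁻ z, ENNReal.ofReal (powGap (p - 1) (f x) (f (x + z))) ∂κ
        ∂compoundPoisson κ 1 := by
  set D := ∫⁻ x, ∫⁻ z, ENNReal.ofReal (powGap (p - 1) (f x) (f (x + z))) ∂κ
    ∂compoundPoisson κ 1
  set m := κ.real Set.univ
  set C := ENNReal.ofReal (k * k ^ (p - 1))
  have hbound : ∀ n : ℕ, ENNReal.ofReal (∫ x, f x ^ p ∂compoundPoisson κ 1 -
      (∫ x, f x ∂compoundPoisson κ 1) ^ p) ≤ ENNReal.ofReal p *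
        (ENNReal.ofReal (Real.exp (1 / ((n : ℝ) + 1) * m)) * D +
          ENNReal.ofReal (1 / ((n : ℝ) + 1)) * (κ Set.univ ^ 2 * C)) := by
    intro n
    set s : ℝ≥0 := 1 / ((n : ℝ≥0) + 1) with hs
    have hs1 : ((n + 1 : ℕ) : ℝ≥0) * s = 1 := by
      rw [hs]; push_cast; field_simp
    have hs2 : ((n + 1 : ℕ) : ℝ≥0∞) * s = 1 := by exact_mod_cast hs1
    have hsr : (s : ℝ) = 1 / ((n : ℝ) + 1) := by rw [hs]; push_cast; rfl
    have hse : ENNReal.ofReal (1 / ((n : ℝ) + 1)) = s := by rw [← hsr]; simp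
    -- `L` runs from the power of the mean to the mean of the power, so its increments sum to the
    -- entropy.
    let L : ℕ → ℝ := fun i => condPowMean κ p f (i * s) ((n + 1 - i : ℕ) * s)
    have hL0 : L 0 = (∫ x, f x ∂compoundPoisson κ 1) ^ p := by
      simp only [L, condPowMean, Nat.sub_zero, hs1, Nat.cast_zero, zero_mul]
      rw [compoundPoisson_zero, integral_dirac']
      · simp
      · exact ((measurable_integral_add _ hf).pow_const p).stronglyMeasurable
    have hL1 : L (n + 1) = ∫ x, f x ^ p ∂compoundPoisson κ 1 := by
      simp only [L, condPowMean, Nat.sub_self, hs1, Nat.cast_zero, zero_mul]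
      rw [compoundPoisson_zero]
      congr 1; ext x
      rw [integral_dirac']
      · simp
      · exact (by fun_prop : Measurable fun y => f (x + y)).stronglyMeasurable
    have hstep : ∀ i ∈ Finset.range (n + 1), ENNReal.ofReal (L (i + 1) - L i) ≤
        ENNReal.ofReal p * (s * (ENNReal.ofReal (Real.exp (s * m)) * D) +
          (s * κ Set.univ) ^ 2 * C) := by
      intro i hi
      have hi' : i < n + 1 := Finset.mem_range.1 hi
      have h := condPowMean_step κ hp1 hp2 he hf hfm s (i * s) ((n + 1 - (i + 1) : ℕ) * s)
      have hN : n + 1 - i = (n + 1 - (i + 1)) + 1 := by omega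
      have e1 : (i : ℝ≥0) * s + s = ((i + 1 : ℕ) : ℝ≥0) * s := by push_cast; ring
      have e2 : s + ((n + 1 - (i + 1) : ℕ) : ℝ≥0) * s = ((n + 1 - i : ℕ) : ℝ≥0) * s := by
        rw [hN]; push_cast; ring
      have e3 : s + ((i : ℝ≥0) * s + ((n + 1 - (i + 1) : ℕ) : ℝ≥0) * s) = 1 := by
        rw [← hs1, ← add_assoc, add_comm s, e1, ← add_mul, ← Nat.cast_add]
        congr 2; omega
      rw [e1, e2, e3] at h
      exact h
    rw [← hL0, ← hL1, ← Finset.sum_range_sub L (n + 1)]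
    refine (Finset.le_sum_of_subadditive ENNReal.ofReal ENNReal.ofReal_zero.le
      (fun _ _ => ENNReal.ofReal_add_le) _ _).trans ?_
    refine (Finset.sum_le_sum hstep).trans ?_
    rw [Finset.sum_const, Finset.card_range, nsmul_eq_mul, hse, ← hsr]
    refine le_of_eq ?_
    -- The `n + 1` first-order terms add up to the full energy; the second-order ones keep one
    -- factor `s`.
    calc _ = ENNReal.ofReal p * ((((n + 1 : ℕ) : ℝ≥0∞) * s) *
          (ENNReal.ofReal (Real.exp (s * m)) * D) +
          (((n + 1 : ℕ) : ℝ≥0∞) * s) * (s * (κ Set.univ ^ 2 * C))) := by ring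
      _ = _ := by rw [hs2, one_mul, one_mul]
  have hlim0 : Filter.Tendsto (fun n : ℕ => 1 / ((n : ℝ) + 1)) Filter.atTop (nhds 0) :=
    tendsto_one_div_add_atTop_nhds_zero_nat
  have hlim1 : Filter.Tendsto (fun n : ℕ => ENNReal.ofReal (Real.exp (1 / ((n : ℝ) + 1) * m)))
      Filter.atTop (nhds 1) := by
    have := (ENNReal.continuous_ofReal.comp Real.continuous_exp).continuousAt.tendsto.comp
      (hlim0.mul_const m)
    simpa [Function.comp_def] using this
  have hlim2 : Filter.Tendsto (fun n : ℕ => ENNReal.ofReal (1 / ((n : ℝ) + 1)))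
      Filter.atTop (nhds 0) := by
    simpa using ENNReal.tendsto_ofReal hlim0
  have hfin : κ Set.univ ^ 2 * C ≠ ∞ :=
    ENNReal.mul_ne_top (ENNReal.pow_ne_top (measure_ne_top _ _)) ENNReal.ofReal_ne_top
  -- `D` may be infinite; its factor tends to `1 ≠ 0`, so the product still converges.
  have hlim := ENNReal.Tendsto.const_mul (a := ENNReal.ofReal p)
    ((ENNReal.Tendsto.mul_const (b := D) hlim1 (Or.inl one_ne_zero)).add
      (ENNReal.Tendsto.mul_const hlim2 (Or.inr hfin))) (Or.inr ENNReal.ofReal_ne_top)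
  simp only [one_mul, zero_mul, add_zero] at hlim
  exact ge_of_tendsto' hlim hbound

end FiniteEntropy

/-! ### Finitely many jump types: independent Poisson counts -/

section FiniteJumps
open scoped Nat
variable {ι : Type*} [Fintype ι] [DecidableEq ι]

/-- The weight `∏ c_a ^ k_a / k_a!`. -/
noncomputable def multiWeight (c : ι → ℝ) (k : ι → ℕ) : ℝ := ∏ a, c a ^ k a / (k a)!

lemma multiWeight_add_single (c : ι → ℝ) (k : ι → ℕ) (a : ι) :
    c a * multiWeight c k =
      (k + Pi.single a 1 : ι → ℕ) a * multiWeight c (k + Pi.single a 1) := by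
  unfold multiWeight
  rw [← Finset.mul_prod_erase Finset.univ _ (Finset.mem_univ a),
    ← Finset.mul_prod_erase Finset.univ _ (Finset.mem_univ a)]
  have h : ∀ b ∈ Finset.univ.erase a, c b ^ (k + Pi.single a 1 : ι → ℕ) b /
      ((k + Pi.single a 1 : ι → ℕ) b)! = c b ^ k b / (k b)! := by
    intro b hb
    simp [Pi.single_eq_of_ne (Finset.ne_of_mem_erase hb)]
  rw [Finset.prod_congr rfl h]
  simp only [Pi.add_apply, Pi.single_eq_same, Nat.factorial_succ]
  push_cast
  field_simp
  ring

variable [MeasurableSpace ι] [MeasurableSingletonClass ι]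

/-- The multinomial formula, by induction on `N` through the type `a` of the first jump. That type
contributes the factor `k a`, and these factors sum to `N + 1`. -/
lemma measureReal_convPow_single (ν : Measure ι) [IsFiniteMeasure ν] (N : ℕ) (k : ι → ℕ) :
    (convPow (ν.map fun a => (Pi.single a 1 : ι → ℕ)) N).real {k} =
      if ∑ a, k a = N then N ! * multiWeight (fun a => ν.real {a}) k else 0 := by
  have hmeas : Measurable fun a => (Pi.single a 1 : ι → ℕ) := measurable_of_finite _
  induction N generalizing k with
  | zero =>
    simp only [convPow, measureReal_def, Measure.dirac_apply' _ (measurableSet_singleton k)]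
    by_cases hk : k = 0
    · subst hk; simp [multiWeight]
    · have : ¬ ∑ a, k a = 0 := by
        intro h
        exact hk (funext fun a => by simpa using (Finset.sum_eq_zero_iff.1 h) a (Finset.mem_univ a))
      have hk' : (0 : ι → ℕ) ∉ ({k} : Set (ι → ℕ)) := fun h => hk h.symm
      rw [if_neg this, Set.indicator_of_notMem hk']
      simp
  | succ N ih =>
    set κ := ν.map fun a => (Pi.single a 1 : ι → ℕ)
    have hstep : (convPow κ (N + 1)).real {k} =
        ∑ a, ν.real {a} * (convPow κ N).real {y | Pi.single a 1 + y = k} := by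
      rw [convPow, measureReal_def, ← lintegral_indicator_one (measurableSet_singleton k),
        Measure.lintegral_conv (measurable_one.indicator (measurableSet_singleton k)),
        lintegral_map (measurable_of_countable _) hmeas, lintegral_fintype,
        ENNReal.toReal_sum]
      · refine Finset.sum_congr rfl fun a _ => ?_
        rw [ENNReal.toReal_mul, mul_comm]
        congr 1
        rw [measureReal_def, ← lintegral_indicator_one (Set.to_countable _).measurableSet]
        rfl
      · intro a _
        refine ENNReal.mul_ne_top ?_ (measure_ne_top _ _)
        refine ((lintegral_mono fun y => Set.indicator_le_self _ _ _).trans_lt ?_).ne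
        simp
    have hterm : ∀ a, ν.real {a} * (convPow κ N).real {y | Pi.single a 1 + y = k} =
        if ∑ a, k a = N + 1 then k a * (N ! * multiWeight (fun a => ν.real {a}) k) else 0 := by
      intro a
      by_cases hka : k a = 0
      · have : {y : ι → ℕ | Pi.single a 1 + y = k} = ∅ := by
          ext y
          simp only [Set.mem_ofPred_eq, Set.mem_empty_iff_false, iff_false]
          rintro rfl
          simp at hka
        simp [this, hka]
      · obtain ⟨l, rfl⟩ : ∃ l, k = l + Pi.single a 1 := ⟨k - Pi.single a 1, by
          ext b
          by_cases hb : b = a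
          · subst hb; simp; omega
          · simp [Pi.single_eq_of_ne hb]⟩
        have : {y : ι → ℕ | Pi.single a 1 + y = l + Pi.single a 1} = {l} := by
          ext y
          simp [add_comm l]
        rw [this, ih]
        have hs : ∑ b, (l + Pi.single a 1 : ι → ℕ) b = ∑ b, l b + 1 := by
          simp [Finset.sum_add_distrib]
        rw [hs]
        simp only [add_left_inj]
        split_ifs
        · have h := multiWeight_add_single (fun a => ν.real {a}) l a
          rw [mul_left_comm, h]
          ring
        · simp
    rw [hstep, Finset.sum_congr rfl fun a _ => hterm a]
    split_ifs with h
    · rw [← Finset.sum_mul, ← Nat.cast_sum, h, Nat.factorial_succ]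
      push_cast; ring
    · simp

/-- Counting the jumps of each of finitely many types yields independent Poisson variables. -/
lemma compoundPoisson_single (ν : Measure ι) [IsFiniteMeasure ν] :
    compoundPoisson (ν.map fun a => (Pi.single a 1 : ι → ℕ)) 1 =
      Measure.pi fun a => poissonMeasure (ν {a}).toNNReal := by
  have hmeas : Measurable fun a => (Pi.single a 1 : ι → ℕ) := measurable_of_finite _
  refine Measure.ext_of_singleton fun k => ?_
  rw [Measure.pi_singleton, ← lintegral_indicator_one (measurableSet_singleton k),
    lintegral_compoundPoisson]
  simp_rw [lintegral_indicator_one (measurableSet_singleton k), poissonMeasure_singleton]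
  -- The vector `k` fixes the total number of jumps, so a single term survives.
  rw [tsum_eq_single (∑ a, k a)]
  · rw [← ofReal_measureReal (μ := convPow _ _), measureReal_convPow_single, if_pos rfl,
      jumpWeight, ← ENNReal.ofReal_mul (by positivity),
      ← ENNReal.ofReal_prod_of_nonneg fun _ _ => by positivity]
    congr 1
    have hm : (ν.map fun a => (Pi.single a 1 : ι → ℕ)).real Set.univ = ∑ a, ν.real {a} := by
      rw [map_measureReal_apply hmeas MeasurableSet.univ, Set.preimage_univ,
        sum_measureReal_singleton]
      simp
    rw [hm]
    simp only [NNReal.coe_one, one_mul, one_pow, mul_one, multiWeight]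
    have hr : ∀ a, (((ν {a}).toNNReal : ℝ≥0) : ℝ) = ν.real {a} := fun _ => rfl
    simp_rw [hr, mul_div_assoc, Finset.prod_mul_distrib, ← Real.exp_sum, Finset.sum_neg_distrib]
    field_simp
  · intro N hN
    rw [← ofReal_measureReal (μ := convPow _ _), measureReal_convPow_single, if_neg hN.symm]
    simp

end FiniteJumps

/-! ### The monoid of counting measures and finite-partition events -/

namespace CountingMeasure
variable {X : Type*} [MeasurableSpace X]

/-- With superposition as addition, adding a point is adding a jump `single x`, and the compound
Poisson results apply. -/
noncomputable instance : Add (CountingMeasure X) where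
  add ξ ζ := ⟨ξ.1 + ζ.1, by
    have := ξ.2.1
    have := ζ.2.1
    refine ⟨inferInstance, fun B hB => ?_⟩
    obtain ⟨n, hn⟩ := ξ.2.2 B hB
    obtain ⟨m, hm⟩ := ζ.2.2 B hB
    exact ⟨n + m, by simp [hn, hm]⟩⟩

instance : Zero (CountingMeasure X) where
  zero := ⟨0, inferInstance, fun _ _ => ⟨0, by simp⟩⟩

noncomputable instance : AddCommMonoid (CountingMeasure X) where
  add_assoc _ _ _ := Subtype.ext (add_assoc _ _ _)
  zero_add _ := Subtype.ext (zero_add _)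
  add_zero _ := Subtype.ext (add_zero _)
  add_comm _ _ := Subtype.ext (add_comm _ _)
  nsmul := nsmulRec

instance : MeasurableAdd₂ (CountingMeasure X) where
  measurable_add := ((measurable_subtype_coe.comp measurable_fst).add
    (measurable_subtype_coe.comp measurable_snd)).subtype_mk

lemma measurable_eval {B : Set X} (hB : MeasurableSet B) :
    Measurable fun ξ : CountingMeasure X => ξ.1 B :=
  (Measure.measurable_coe hB).comp measurable_subtype_coe

/-- A map into the space of counting measures is measurable as soon as its evaluations are. -/
lemma measurable_of_eval {Ω : Type*} [MeasurableSpace Ω] {φ : Ω → CountingMeasure X}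
    (h : ∀ B, MeasurableSet B → Measurable fun ω => (φ ω).1 B) : Measurable φ :=
  (Measure.measurable_of_measurable_coe (fun ω => (φ ω).1) h).subtype_mk

/-- The point mass at `x`, as a counting measure. -/
noncomputable def single (x : X) : CountingMeasure X :=
  ⟨Measure.dirac x, inferInstance, fun B hB => by
    by_cases hx : x ∈ B
    · exact ⟨1, by simp [Measure.dirac_apply' x hB, hx]⟩
    · exact ⟨0, by simp [Measure.dirac_apply' x hB, hx]⟩⟩

lemma measurable_single : Measurable (single : X → CountingMeasure X) :=
  Measure.measurable_dirac.subtype_mk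

lemma addDirac_eq (ξ : CountingMeasure X) (x : X) : ξ.addDirac x = ξ + single x := rfl

/-- Restriction of counting measures to a measurable set. -/
noncomputable def restrict {B : Set X} (hB : MeasurableSet B) :
    CountingMeasure X →+ CountingMeasure X where
  toFun ξ := ⟨ξ.1.restrict B, by
    have := ξ.2.1
    refine ⟨inferInstance, fun C hC => ?_⟩
    rw [Measure.restrict_apply hC]
    exact ξ.2.2 _ (hC.inter hB)⟩
  map_zero' := Subtype.ext (Measure.restrict_zero B)
  map_add' ξ ζ := Subtype.ext (Measure.restrict_add ξ.1 ζ.1 B)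

lemma restrict_apply {B C : Set X} (hB : MeasurableSet B) (hC : MeasurableSet C)
    (ξ : CountingMeasure X) : (restrict hB ξ).1 C = ξ.1 (C ∩ B) :=
  Measure.restrict_apply hC

lemma measurable_restrict {B : Set X} (hB : MeasurableSet B) :
    Measurable (restrict hB : CountingMeasure X → CountingMeasure X) :=
  measurable_of_eval fun C hC => by
    simp_rw [restrict_apply hB hC]
    exact measurable_eval (hC.inter hB)

lemma restrict_add_restrict_compl {B : Set X} (hB : MeasurableSet B) (ξ : CountingMeasure X) :
    restrict hB ξ + restrict hB.compl ξ = ξ :=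
  Subtype.ext (Measure.restrict_add_restrict_compl hB)

lemma restrict_restrict_of_subset {B C : Set X} (hB : MeasurableSet B) (hC : MeasurableSet C)
    (h : B ⊆ C) (ξ : CountingMeasure X) : restrict hB (restrict hC ξ) = restrict hB ξ :=
  Subtype.ext (Measure.restrict_restrict_of_subset h)

/-- The numbers of points in the cells of a finite measurable partition. -/
noncomputable def cells {n : ℕ} (e : X → Fin n) :
    CountingMeasure X →+ (Fin n → ℝ≥0∞) where
  toFun ξ a := ξ.1 (e ⁻¹' {a})
  map_zero' := rfl
  map_add' _ _ := rfl

lemma cells_apply {n : ℕ} (e : X → Fin n) (ξ : CountingMeasure X)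
    (a : Fin n) : cells e ξ a = ξ.1 (e ⁻¹' {a}) := rfl

lemma measurable_cells {n : ℕ} (e : X → Fin n) (he : Measurable e) :
    Measurable (cells e) :=
  measurable_pi_lambda _ fun a => measurable_eval (he (measurableSet_singleton a))

/-- The events that depend only on the numbers of points in the cells of some finite partition. -/
def cylinders (X : Type*) [MeasurableSpace X] : Set (Set (CountingMeasure X)) :=
  {S | ∃ (n : ℕ) (e : X → Fin n) (T : Set (Fin n → ℝ≥0∞)),
    Measurable e ∧ MeasurableSet T ∧ cells e ⁻¹' T = S}

/-- Each coarse cell is a finite disjoint union of fine cells, so its count is a sum of fine counts.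
-/
lemma exists_refinement {n N : ℕ} (e : X → Fin n) (e' : X → Fin N)
    (he' : Measurable e') (φ : Fin N → Fin n) (h : ∀ x, e x = φ (e' x)) :
    ∃ r : (Fin N → ℝ≥0∞) → (Fin n → ℝ≥0∞), Measurable r ∧
      ∀ ξ, cells e ξ = r (cells e' ξ) := by
  classical
  refine ⟨fun v a => ∑ b ∈ Finset.univ.filter fun b => φ b = a, v b, by fun_prop, fun ξ => ?_⟩
  ext a
  have hU : e ⁻¹' {a} = ⋃ b ∈ Finset.univ.filter fun b => φ b = a, e' ⁻¹' {b} := by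
    ext x; simp [h]
  simp only [cells_apply]
  rw [hU, measure_biUnion_finset]
  · intro b _ c _ hbc
    exact Disjoint.preimage _ (by simpa using hbc)
  · intro b _
    exact he' (measurableSet_singleton b)

lemma isPiSystem_cylinders : IsPiSystem (cylinders X) := by
  rintro _ ⟨n, e, T, he, hT, rfl⟩ _ ⟨m, e', T', he', hT', rfl⟩ -
  -- The common refinement of the two partitions, with cells relabelled by `Fin (n * m)`.
  have hc : Measurable fun x => finProdFinEquiv (e x, e' x) :=
    (measurable_of_finite finProdFinEquiv).comp (he.prodMk he')
  obtain ⟨r, hr, h⟩ := exists_refinement e _ hc (fun i => (finProdFinEquiv.symm i).1) (by simp)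
  obtain ⟨r', hr', h'⟩ := exists_refinement e' _ hc (fun i => (finProdFinEquiv.symm i).2) (by simp)
  refine ⟨n * m, _, r ⁻¹' T ∩ r' ⁻¹' T', hc, (hr hT).inter (hr' hT'), ?_⟩
  ext ξ
  simp only [Set.mem_preimage, Set.mem_inter_iff, h, h']

lemma measurableSet_of_mem_cylinders {S : Set (CountingMeasure X)} (hS : S ∈ cylinders X) :
    MeasurableSet S := by
  obtain ⟨n, e, T, he, hT, rfl⟩ := hS
  exact measurable_cells e he hT

lemma generateFrom_cylinders :
    (Subtype.instMeasurableSpace : MeasurableSpace (CountingMeasure X)) =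
      MeasurableSpace.generateFrom (cylinders X) := by
  classical
  refine le_antisymm ?_ (MeasurableSpace.generateFrom_le fun S hS =>
    measurableSet_of_mem_cylinders hS)
  refine Measurable.comap_le (@Measure.measurable_of_measurable_coe X _ _
    (MeasurableSpace.generateFrom (cylinders X)) Subtype.val fun B hB T hT => ?_)
  refine MeasurableSpace.measurableSet_generateFrom
    ⟨2, fun x => if x ∈ B then 1 else 0, {v | v 1 ∈ T},
      Measurable.ite hB measurable_const measurable_const, measurable_pi_apply 1 hT, ?_⟩
  have h : (fun x => if x ∈ B then (1 : Fin 2) else 0) ⁻¹' {1} = B := by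
    ext x; by_cases hx : x ∈ B <;> simp [hx]
  ext ξ
  simp only [Set.mem_preimage, Set.mem_ofPred_eq, cells_apply, h]

/-- The law of a random counting measure is determined by its values on finite partitions. -/
lemma ext_of_map_cells {ρ₁ ρ₂ : Measure (CountingMeasure X)} [IsProbabilityMeasure ρ₁]
    [IsProbabilityMeasure ρ₂]
    (h : ∀ (n : ℕ) (e : X → Fin n), Measurable e → ρ₁.map (cells e) = ρ₂.map (cells e)) :
    ρ₁ = ρ₂ := by
  refine ext_of_generate_finite _ generateFrom_cylinders isPiSystem_cylinders ?_ (by simp)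
  rintro _ ⟨n, e, T, he, hT, rfl⟩
  rw [← Measure.map_apply (measurable_cells e he) hT, h n e he,
    Measure.map_apply (measurable_cells e he) hT]

lemma cells_single {n : ℕ} (e : X → Fin n) (he : Measurable e) (x : X) :
    cells e (single x) = fun a => ((Pi.single (e x) 1 : Fin n → ℕ) a : ℝ≥0∞) := by
  ext a
  rw [cells_apply, single, Measure.dirac_apply' _ (he (measurableSet_singleton a))]
  by_cases h : e x = a
  · subst h; simp
  · simp [h]

/-- The jump measure on counting measures associated with `μ` restricted to `B`. -/
noncomputable def jumpMeasure (μ : Measure X) (B : Set X) : Measure (CountingMeasure X) :=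
  (μ.restrict B).map single

instance (μ : Measure X) (B : Set X) [IsFiniteMeasure (μ.restrict B)] :
    IsFiniteMeasure (jumpMeasure μ B) := by
  unfold jumpMeasure; infer_instance

/-- A point at `x` adds the unit vector at `e x` to the counts. Factoring through `Fin n → ℕ`
reduces the claim to `compoundPoisson_single`. -/
lemma map_cells_compoundPoisson (μ : Measure X) {B : Set X} [IsFiniteMeasure (μ.restrict B)]
    {n : ℕ} (e : X → Fin n) (he : Measurable e) :
    (compoundPoisson (jumpMeasure μ B) 1).map (cells e) =
      Measure.pi fun a => extPoissonLaw (μ.restrict B (e ⁻¹' {a})) := by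
  let castHom : (Fin n → ℕ) →+ (Fin n → ℝ≥0∞) :=
    { toFun := fun k a => (k a : ℝ≥0∞), map_zero' := by ext; simp, map_add' := by intros; ext; simp }
  have hcast : Measurable castHom := measurable_of_countable _
  have hs : Measurable fun a => (Pi.single a 1 : Fin n → ℕ) := measurable_of_finite _
  have h1 : (jumpMeasure μ B).map (cells e) =
      (((μ.restrict B).map e).map fun a => (Pi.single a 1 : Fin n → ℕ)).map castHom := by
    rw [jumpMeasure, Measure.map_map (measurable_cells e he) measurable_single,
      Measure.map_map hs he, Measure.map_map hcast (hs.comp he)]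
    congr 1
    ext x : 1
    exact cells_single e he x
  rw [map_compoundPoisson _ _ (measurable_cells e he), h1, ← map_compoundPoisson _ _ hcast,
    compoundPoisson_single]
  change Measure.map (fun (k : Fin n → ℕ) a => (k a : ℝ≥0∞)) _ = _
  rw [Measure.pi_map_pi fun a => (measurable_of_countable (Nat.cast : ℕ → ℝ≥0∞)).aemeasurable]
  congr 1
  ext a : 1
  rw [Measure.map_apply he (measurableSet_singleton a), extPoissonLaw,
    if_neg (measure_ne_top _ _)]

end CountingMeasure

/-! ### Law and independence of restrictions of the Poisson process -/

namespace IsPoissonProcess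
open CountingMeasure
variable {X Ω : Type*} [MeasurableSpace X] [MeasurableSpace Ω] {μ : Measure X} {P : Measure Ω}
  {η : Ω → CountingMeasure X} {B : Set X}

lemma iIndepFun_cells (hη : IsPoissonProcess η μ P) (hB : MeasurableSet B) {n : ℕ}
    (e : X → Fin n) (he : Measurable e) :
    iIndepFun (fun a ω => (η ω).1 (e ⁻¹' {a} ∩ B)) P :=
  hη.indep n _ (fun a => (he (measurableSet_singleton a)).inter hB) fun a b hab =>
    (Disjoint.preimage e (by simpa using hab)).mono Set.inter_subset_left Set.inter_subset_left

variable [IsProbabilityMeasure P]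

/-- In a set of finite intensity, a Poisson process has a compound Poisson law. -/
lemma map_restrict (hη : IsPoissonProcess η μ P) (hB : MeasurableSet B)
    [IsFiniteMeasure (μ.restrict B)] :
    P.map (fun ω => restrict hB (η ω)) = compoundPoisson (jumpMeasure μ B) 1 := by
  have hm : Measurable fun ω => restrict hB (η ω) := (measurable_restrict hB).comp hη.measurable
  have := Measure.isProbabilityMeasure_map (μ := P) hm.aemeasurable
  refine ext_of_map_cells fun n e he => ?_
  rw [map_cells_compoundPoisson μ e he, Measure.map_map (measurable_cells e he) hm]
  have hc : ∀ a, MeasurableSet (e ⁻¹' {a}) := fun a => he (measurableSet_singleton a)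
  have hfun : (cells e ∘ fun ω => restrict hB (η ω)) = fun ω a => (η ω).1 (e ⁻¹' {a} ∩ B) := by
    ext ω a
    exact restrict_apply hB (hc a) _
  have hea : ∀ a, AEMeasurable (fun ω => (η ω).1 (e ⁻¹' {a} ∩ B)) P := fun a =>
    ((measurable_eval ((hc a).inter hB)).comp hη.measurable).aemeasurable
  rw [hfun, (iIndepFun_iff_map_fun_eq_pi_map hea).1 (hη.iIndepFun_cells hB e he)]
  congr 1
  ext a : 1
  rw [hη.law _ ((hc a).inter hB), Measure.restrict_apply (hc a)]

/-- Restrictions of a Poisson process to complementary sets are independent. -/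
lemma indepFun_restrict (hη : IsPoissonProcess η μ P) (hB : MeasurableSet B) :
    IndepFun (fun ω => restrict hB (η ω)) (fun ω => restrict hB.compl (η ω)) P := by
  have hm : Measurable fun ω => restrict hB (η ω) := (measurable_restrict hB).comp hη.measurable
  have hm' : Measurable fun ω => restrict hB.compl (η ω) :=
    (measurable_restrict hB.compl).comp hη.measurable
  refine IndepSets.indep hm.comap_le hm'.comap_le
    (isPiSystem_cylinders.comap fun ω => restrict hB (η ω))
    (isPiSystem_cylinders.comap fun ω => restrict hB.compl (η ω))
    (by rw [generateFrom_cylinders, MeasurableSpace.comap_generateFrom]; rfl)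
    (by rw [generateFrom_cylinders, MeasurableSpace.comap_generateFrom]; rfl) ?_
  rw [IndepSets_iff]
  rintro _ _ ⟨_, ⟨n, e, T, he, hT, rfl⟩, rfl⟩ ⟨_, ⟨m, e', T', he', hT', rfl⟩, rfl⟩
  -- The cells inside `B` and those outside form one disjoint family, to which complete independence
  -- applies; the two blocks of counts are then independent.
  let D : Fin n ⊕ Fin m → Set X :=
    Sum.elim (fun a => e ⁻¹' {a} ∩ B) (fun b => e' ⁻¹' {b} ∩ Bᶜ)
  have hD : ∀ i, MeasurableSet (D i) := by
    rintro (a | b)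
    · exact (he (measurableSet_singleton a)).inter hB
    · exact (he' (measurableSet_singleton b)).inter hB.compl
  have hdisj : ∀ i j, i ≠ j → Disjoint (D i) (D j) := by
    rintro (a | b) (a' | b') hij
    · exact (Disjoint.preimage e (by simpa using hij)).mono Set.inter_subset_left
        Set.inter_subset_left
    · exact disjoint_compl_right.mono Set.inter_subset_right Set.inter_subset_right
    · exact disjoint_compl_left.mono Set.inter_subset_right Set.inter_subset_right
    · exact (Disjoint.preimage e' (by simpa using hij)).mono Set.inter_subset_left
        Set.inter_subset_left
  have hI : iIndepFun (fun i ω => (η ω).1 (D i)) P := by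
    have h := hη.indep (n + m) (fun i => D (finSumFinEquiv.symm i)) (fun i => hD _)
      fun i j hij => hdisj _ _ (by simpa using hij)
    have h2 := h.precomp finSumFinEquiv.injective
    simpa [Function.comp_def] using h2
  have hDm : ∀ i, Measurable fun ω => (η ω).1 (D i) := fun i =>
    (measurable_eval (hD i)).comp hη.measurable
  let I : Finset (Fin n ⊕ Fin m) := Finset.univ.map Function.Embedding.inl
  let J : Finset (Fin n ⊕ Fin m) := Finset.univ.map Function.Embedding.inr
  have hF := hI.indepFun_finset I J (by rw [Finset.disjoint_left]; simp [I, J]) hDm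
  have hG := hF.comp
    (φ := fun (v : I → ℝ≥0∞) (a : Fin n) => v ⟨Sum.inl a, by simp [I]⟩)
    (ψ := fun (v : J → ℝ≥0∞) (b : Fin m) => v ⟨Sum.inr b, by simp [J]⟩)
    (measurable_pi_lambda _ fun a => measurable_pi_apply _)
    (measurable_pi_lambda _ fun a => measurable_pi_apply _)
  rw [indepFun_iff_measure_inter_preimage_eq_mul] at hG
  have h := hG T T' hT hT'
  convert h using 3 <;>
  · ext ω
    simp only [Set.mem_preimage, Function.comp_apply]
    congr! 1
    ext a
    simp only [cells_apply, D, Sum.elim_inl, Sum.elim_inr]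
    exact restrict_apply _ (by first | exact he (measurableSet_singleton a)
                                     | exact he' (measurableSet_singleton a)) _

end IsPoissonProcess

/-! ### From finite to sigma-finite intensity by conditioning -/

namespace IsPoissonProcess
open CountingMeasure
variable {X Ω : Type*} [MeasurableSpace X] [MeasurableSpace Ω] {μ : Measure X} {P : Measure Ω}
  {η : Ω → CountingMeasure X} {B : Set X}

lemma measurable_restrict_prodMk (hη : IsPoissonProcess η μ P) (hB : MeasurableSet B) :
    Measurable fun ω => (restrict hB (η ω), restrict hB.compl (η ω)) :=
  ((measurable_restrict hB).comp hη.measurable).prodMk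
    ((measurable_restrict hB.compl).comp hη.measurable)

/-- The filtration generated by the restrictions of `η` to the spanning sets of `μ`. -/
noncomputable def spanningFiltration [SigmaFinite μ] (hη : IsPoissonProcess η μ P) :
    Filtration ℕ (inferInstance : MeasurableSpace Ω) where
  seq n := MeasurableSpace.comap (restrict (measurableSet_spanningSets μ n) ∘ η) inferInstance
  mono' i j hij := by
    refine Measurable.comap_le ?_
    have h : restrict (measurableSet_spanningSets μ i) ∘ η =
        restrict (measurableSet_spanningSets μ i) ∘
          (restrict (measurableSet_spanningSets μ j) ∘ η) := by
      ext ω : 1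
      exact (restrict_restrict_of_subset _ _ (monotone_spanningSets μ hij) _).symm
    rw [h]
    exact (measurable_restrict _).comp (comap_measurable _)
  le' n := ((measurable_restrict _).comp hη.measurable).comap_le

/-- Every count is the increasing limit of the counts within the spanning sets. -/
lemma measurable_iSup_spanningFiltration [SigmaFinite μ] (hη : IsPoissonProcess η μ P) :
    Measurable[⨆ n, hη.spanningFiltration n] η := by
  have hle : ∀ n, MeasurableSpace.comap (restrict (measurableSet_spanningSets μ n) ∘ η)
      inferInstance ≤ ⨆ n, hη.spanningFiltration n :=
    le_iSup fun n => (hη.spanningFiltration n : MeasurableSpace Ω)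
  generalize (⨆ n, (hη.spanningFiltration n : MeasurableSpace Ω)) = m at hle ⊢
  refine measurable_of_eval fun C hC => ?_
  have h : (fun ω => (η ω).1 C) = fun ω => ⨆ n,
      (restrict (measurableSet_spanningSets μ n) (η ω)).1 C := by
    ext ω
    simp_rw [restrict_apply _ hC]
    rw [← Monotone.measure_iUnion, ← Set.inter_iUnion, iUnion_spanningSets, Set.inter_univ]
    exact fun i j hij => Set.inter_subset_inter_right _ (monotone_spanningSets μ hij)
  rw [h]
  refine Measurable.iSup fun n => (measurable_eval hC).comp ?_
  exact (comap_measurable (restrict (measurableSet_spanningSets μ n) ∘ η)).mono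
    (hle n) le_rfl

variable [IsProbabilityMeasure P]

/-- The law of the part of `η` outside `B`. -/
noncomputable def outerLaw (P : Measure Ω) (η : Ω → CountingMeasure X) {B : Set X}
    (hB : MeasurableSet B) : Measure (CountingMeasure X) :=
  P.map fun ω => restrict hB.compl (η ω)

lemma isProbabilityMeasure_outerLaw (hη : IsPoissonProcess η μ P) (hB : MeasurableSet B) :
    IsProbabilityMeasure (outerLaw P η hB) :=
  Measure.isProbabilityMeasure_map ((measurable_restrict hB.compl).comp hη.measurable).aemeasurable

lemma map_restrict_prodMk (hη : IsPoissonProcess η μ P) (hB : MeasurableSet B)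
    [IsFiniteMeasure (μ.restrict B)] :
    P.map (fun ω => (restrict hB (η ω), restrict hB.compl (η ω))) =
      (compoundPoisson (jumpMeasure μ B) 1).prod (outerLaw P η hB) := by
  rw [← hη.map_restrict hB]
  exact (indepFun_iff_map_prod_eq_prod_map_map
    ((measurable_restrict hB).comp hη.measurable).aemeasurable
    ((measurable_restrict hB.compl).comp hη.measurable).aemeasurable).1 (hη.indepFun_restrict hB)

lemma lintegral_eq (hη : IsPoissonProcess η μ P) (hB : MeasurableSet B)
    [IsFiniteMeasure (μ.restrict B)] {G : CountingMeasure X → ℝ≥0∞} (hG : Measurable G) :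
    ∫⁻ ω, G (η ω) ∂P = ∫⁻ ξ, ∫⁻ ζ, G (ξ + ζ) ∂outerLaw P η hB
      ∂compoundPoisson (jumpMeasure μ B) 1 := by
  have := hη.isProbabilityMeasure_outerLaw hB
  rw [← lintegral_prod (fun z : CountingMeasure X × CountingMeasure X => G (z.1 + z.2))
    (by fun_prop), ← hη.map_restrict_prodMk hB,
    lintegral_map (by fun_prop) (hη.measurable_restrict_prodMk hB)]
  simp_rw [restrict_add_restrict_compl]

/-- The conditional expectation of `f η` given the restriction of `η` to `B`, as a function of
this restriction. -/
noncomputable def innerMean (P : Measure Ω) (η : Ω → CountingMeasure X) {B : Set X}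
    (hB : MeasurableSet B) (f : CountingMeasure X → ℝ) (ξ : CountingMeasure X) : ℝ :=
  ∫ ζ, f (ξ + ζ) ∂outerLaw P η hB

variable {f : CountingMeasure X → ℝ} {e k : ℝ}

lemma measurable_innerMean (hη : IsPoissonProcess η μ P) (hB : MeasurableSet B)
    (hf : Measurable f) : Measurable (innerMean P η hB f) :=
  have := hη.isProbabilityMeasure_outerLaw hB
  measurable_integral_add _ hf

lemma innerMean_mem_Icc (hη : IsPoissonProcess η μ P) (hB : MeasurableSet B)
    (hf : Measurable f) (hfm : ∀ ξ, f ξ ∈ Set.Icc e k) (ξ : CountingMeasure X) :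
    innerMean P η hB f ξ ∈ Set.Icc e k :=
  have := hη.isProbabilityMeasure_outerLaw hB
  integral_add_mem_Icc _ hf hfm ξ

/-- Fubini for the independent parts of `η` inside and outside `B`. General `S` identifies the
conditional expectation; `S = univ` gives the mean. -/
lemma integral_indicator_innerMean (hη : IsPoissonProcess η μ P) (hB : MeasurableSet B)
    [IsFiniteMeasure (μ.restrict B)] (hf : Measurable f) (hfm : ∀ ξ, f ξ ∈ Set.Icc e k)
    {S : Set (CountingMeasure X)} (hS : MeasurableSet S) :
    ∫ ξ, S.indicator (innerMean P η hB f) ξ ∂compoundPoisson (jumpMeasure μ B) 1 =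
      ∫ ω, (restrict hB ∘ η ⁻¹' S).indicator (fun ω => f (η ω)) ω ∂P := by
  have := hη.isProbabilityMeasure_outerLaw hB
  have hm : Measurable fun z : CountingMeasure X × CountingMeasure X =>
      (Prod.fst ⁻¹' S).indicator (fun z => f (z.1 + z.2)) z :=
    Measurable.indicator (by fun_prop) (measurable_fst hS)
  have hi : Integrable (fun z : CountingMeasure X × CountingMeasure X =>
      (Prod.fst ⁻¹' S).indicator (fun z => f (z.1 + z.2)) z)
      ((compoundPoisson (jumpMeasure μ B) 1).prod (outerLaw P η hB)) :=
    (integrable_of_mem_Icc (by fun_prop) fun z => hfm (z.1 + z.2)).indicator (measurable_fst hS)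
  have h := integral_prod _ hi
  rw [← hη.map_restrict_prodMk hB, integral_map (hη.measurable_restrict_prodMk hB).aemeasurable
    hm.aestronglyMeasurable] at h
  calc _ = ∫ ξ, ∫ ζ, (Prod.fst ⁻¹' S).indicator (fun z : CountingMeasure X × CountingMeasure X =>
        f (z.1 + z.2)) (ξ, ζ) ∂outerLaw P η hB ∂compoundPoisson (jumpMeasure μ B) 1 := by
        congr 1; ext ξ
        by_cases hξ : ξ ∈ S <;> simp [Set.indicator, hξ, innerMean]
    _ = _ := by
        rw [← h]
        congr 1; ext ω
        by_cases hω : restrict hB (η ω) ∈ S <;>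
          simp [Set.indicator, hω, restrict_add_restrict_compl]

lemma integral_comp_restrict (hη : IsPoissonProcess η μ P) (hB : MeasurableSet B)
    [IsFiniteMeasure (μ.restrict B)] {g : CountingMeasure X → ℝ} (hg : Measurable g) :
    ∫ ω, g (restrict hB (η ω)) ∂P = ∫ ξ, g ξ ∂compoundPoisson (jumpMeasure μ B) 1 := by
  have hr : Measurable fun ω => restrict hB (η ω) := (measurable_restrict hB).comp hη.measurable
  rw [← hη.map_restrict hB, integral_map hr.aemeasurable hg.aestronglyMeasurable]

lemma innerMean_ae_eq_condExp (hη : IsPoissonProcess η μ P) (hB : MeasurableSet B)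
    [IsFiniteMeasure (μ.restrict B)] (hf : Measurable f) (hfm : ∀ ξ, f ξ ∈ Set.Icc e k) :
    (fun ω => innerMean P η hB f (restrict hB (η ω))) =ᵐ[P]
      P[fun ω => f (η ω) | MeasurableSpace.comap (restrict hB ∘ η) inferInstance] := by
  have hr : Measurable (restrict hB ∘ η) := (measurable_restrict hB).comp hη.measurable
  have hg := hη.measurable_innerMean hB hf
  refine ae_eq_condExp_of_forall_setIntegral_eq hr.comap_le
    (integrable_of_mem_Icc (hf.comp hη.measurable) fun ω => hfm _)
    (fun s _ _ => (integrable_of_mem_Icc (hg.comp hr)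
      fun ω => hη.innerMean_mem_Icc hB hf hfm _).integrableOn) ?_
    (hg.comp (comap_measurable _)).stronglyMeasurable.aestronglyMeasurable
  rintro _ ⟨S, hS, rfl⟩ -
  rw [← integral_indicator (hr hS), ← integral_indicator (hr hS),
    ← hη.integral_indicator_innerMean hB hf hfm hS,
    ← hη.integral_comp_restrict hB (hg.indicator hS)]
  rfl

/-- The entropy inequality for the conditional expectation of a bounded functional given the
restriction of the Poisson process to a set of finite intensity. -/
lemma ofReal_entropy_innerMean_le (hη : IsPoissonProcess η μ P) (hB : MeasurableSet B)
    [IsFiniteMeasure (μ.restrict B)] (hf : Measurable f) (hfm : ∀ ξ, f ξ ∈ Set.Icc e k)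
    (he : 0 < e) {p : ℝ} (hp1 : 1 ≤ p) (hp2 : p ≤ 2) :
    ENNReal.ofReal (∫ ω, innerMean P η hB f (restrict hB (η ω)) ^ p ∂P -
      (∫ ω, f (η ω) ∂P) ^ p) ≤ ENNReal.ofReal p * ∫⁻ ω, ∫⁻ x in B,
        ENNReal.ofReal (powGap (p - 1) (f (η ω)) (f ((η ω).addDirac x))) ∂μ ∂P := by
  have := hη.isProbabilityMeasure_outerLaw hB
  have hg := hη.measurable_innerMean hB hf
  have e1 : ∫ ω, f (η ω) ∂P =
      ∫ ξ, innerMean P η hB f ξ ∂compoundPoisson (jumpMeasure μ B) 1 := by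
    simpa using (hη.integral_indicator_innerMean hB hf hfm MeasurableSet.univ).symm
  rw [e1, hη.integral_comp_restrict hB (hg.pow_const p)]
  refine (ofReal_entropy_compoundPoisson_le (jumpMeasure μ B) hp1 hp2 he hg
    (hη.innerMean_mem_Icc hB hf hfm)).trans ?_
  refine mul_le_mul_right ?_ _
  have hβ := measurable_lintegral_powGap_add (jumpMeasure μ B) (p - 1) hf
  have e2 : ∀ ω, ∫⁻ x in B, ENNReal.ofReal (powGap (p - 1) (f (η ω)) (f ((η ω).addDirac x))) ∂μ =
      ∫⁻ z, ENNReal.ofReal (powGap (p - 1) (f (η ω)) (f (η ω + z))) ∂jumpMeasure μ B := by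
    intro ω
    rw [jumpMeasure, lintegral_map (measurable_powGap _ (by fun_prop)
      (by fun_prop)).ennreal_ofReal measurable_single]
    rfl
  rw [lintegral_congr e2, hη.lintegral_eq hB hβ]
  -- Jensen again: averaging out the points outside `B` does not increase the energy.
  exact lintegral_mono fun ξ => lintegral_powGap_integral_add_le (jumpMeasure μ B)
    (outerLaw P η hB) (by linarith) (by linarith) he hf hfm ξ

/-- Lévy's upward theorem; the limit is `f (η ω)` itself because `η` is measurable for the limiting
sigma-field. -/
lemma tendsto_innerMean [SigmaFinite μ] (hη : IsPoissonProcess η μ P) (hf : Measurable f)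
    (hfm : ∀ ξ, f ξ ∈ Set.Icc e k) :
    ∀ᵐ ω ∂P, Filter.Tendsto (fun n => innerMean P η (measurableSet_spanningSets μ n) f
      (restrict (measurableSet_spanningSets μ n) (η ω))) Filter.atTop (nhds (f (η ω))) := by
  have hfin : ∀ n, IsFiniteMeasure (μ.restrict (spanningSets μ n)) := fun n =>
    isFiniteMeasure_restrict.2 (measure_spanningSets_lt_top μ n).ne
  have hlevy := tendsto_ae_condExp (μ := P) (ℱ := hη.spanningFiltration) (fun ω => f (η ω))
  have hlim : P[fun ω => f (η ω) | ⨆ n, hη.spanningFiltration n] = fun ω => f (η ω) :=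
    condExp_of_stronglyMeasurable (iSup_le fun n => hη.spanningFiltration.le n)
      (hf.comp hη.measurable_iSup_spanningFiltration).stronglyMeasurable
      (integrable_of_mem_Icc (hf.comp hη.measurable) fun ω => hfm _)
  have hcond := ae_all_iff.2 fun n => (hη.innerMean_ae_eq_condExp
    (measurableSet_spanningSets μ n) hf hfm)
  filter_upwards [hlevy, hcond] with ω h1 h2
  rw [hlim] at h1
  exact h1.congr fun n => (h2 n).symm

/-- The entropy inequality for bounded Poisson functionals. -/
theorem ofReal_entropy_le_of_mem_Icc [SigmaFinite μ] (hη : IsPoissonProcess η μ P)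
    (hf : Measurable f) (hfm : ∀ ξ, f ξ ∈ Set.Icc e k) (he : 0 < e) {p : ℝ} (hp1 : 1 ≤ p)
    (hp2 : p ≤ 2) :
    ENNReal.ofReal (∫ ω, f (η ω) ^ p ∂P - (∫ ω, f (η ω) ∂P) ^ p) ≤
      ENNReal.ofReal p * ∫⁻ ω, ∫⁻ x,
        ENNReal.ofReal (powGap (p - 1) (f (η ω)) (f ((η ω).addDirac x))) ∂μ ∂P := by
  have hfin : ∀ n, IsFiniteMeasure (μ.restrict (spanningSets μ n)) := fun n =>
    isFiniteMeasure_restrict.2 (measure_spanningSets_lt_top μ n).ne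
  have hp0 : 0 ≤ p := by linarith
  have hlim : Filter.Tendsto (fun n => ∫ ω, innerMean P η (measurableSet_spanningSets μ n) f
      (restrict (measurableSet_spanningSets μ n) (η ω)) ^ p ∂P) Filter.atTop
      (nhds (∫ ω, f (η ω) ^ p ∂P)) := by
    refine tendsto_integral_of_dominated_convergence (fun _ => k ^ p) (fun n => ?_)
      (integrable_const _) (fun n => .of_forall fun ω => ?_) ?_
    · exact (((hη.measurable_innerMean _ hf).comp
        ((measurable_restrict _).comp hη.measurable)).pow_const p).aestronglyMeasurable
    · have h := hη.innerMean_mem_Icc (measurableSet_spanningSets μ n) hf hfm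
        (restrict (measurableSet_spanningSets μ n) (η ω))
      have h' := rpow_mem_Icc hp0 he h
      rw [Real.norm_of_nonneg (Real.rpow_nonneg (he.le.trans h.1) p)]
      exact h'.2
    · filter_upwards [hη.tendsto_innerMean hf hfm] with ω hω
      exact hω.rpow_const (Or.inr hp0)
  refine le_of_tendsto' (ENNReal.tendsto_ofReal (hlim.sub_const _)) fun n => ?_
  refine (hη.ofReal_entropy_innerMean_le _ hf hfm he hp1 hp2).trans ?_
  refine mul_le_mul_right ?_ _
  exact lintegral_mono fun ω => setLIntegral_le_lintegral _ _

/-- A property that holds almost surely for `η` holds almost surely for almost all `η + δ_x`. -/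
lemma ae_addDirac [SigmaFinite μ] (hη : IsPoissonProcess η μ P) {S : Set (CountingMeasure X)}
    (hS : MeasurableSet S) (h : ∀ᵐ ω ∂P, η ω ∉ S) :
    ∀ᵐ ω ∂P, ∀ᵐ x ∂μ, (η ω).addDirac x ∉ S := by
  have hfin : ∀ n, IsFiniteMeasure (μ.restrict (spanningSets μ n)) := fun n =>
    isFiniteMeasure_restrict.2 (measure_spanningSets_lt_top μ n).ne
  have hI : Measurable (S.indicator (1 : CountingMeasure X → ℝ≥0∞)) := measurable_one.indicator hS
  have h0 : ∫⁻ ω, S.indicator 1 (η ω) ∂P = 0 := by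
    refine (lintegral_eq_zero_iff (hI.comp hη.measurable)).2 ?_
    filter_upwards [h] with ω hω
    simp [hω]
  have key : ∀ n, ∀ᵐ ω ∂P, ∀ᵐ x ∂μ.restrict (spanningSets μ n), (η ω).addDirac x ∉ S := by
    intro n
    set B := spanningSets μ n
    have hB : MeasurableSet B := measurableSet_spanningSets μ n
    have := hη.isProbabilityMeasure_outerLaw hB
    set κ := jumpMeasure μ B
    set L := compoundPoisson κ 1
    have hg : Measurable fun ξ => ∫⁻ ζ, S.indicator (1 : CountingMeasure X → ℝ≥0∞) (ξ + ζ)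
        ∂outerLaw P η hB :=
      Measurable.lintegral_prod_right' (f := fun z : CountingMeasure X × CountingMeasure X =>
        S.indicator 1 (z.1 + z.2)) (by fun_prop)
    rw [hη.lintegral_eq hB hI, lintegral_eq_zero_iff hg] at h0
    -- The law inside `B` with one extra point is absolutely continuous with respect to the law
    -- without it.
    have h1 := (conv_compoundPoisson_absolutelyContinuous κ one_pos).ae_le h0
    have h2 := (lintegral_eq_zero_iff hg).2 h1
    rw [Measure.conv_comm, Measure.lintegral_conv hg] at h2
    have hG : Measurable fun ξ => ∫⁻ z, S.indicator (1 : CountingMeasure X → ℝ≥0∞) (ξ + z) ∂κ :=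
      Measurable.lintegral_prod_right' (f := fun z : CountingMeasure X × CountingMeasure X =>
        S.indicator 1 (z.1 + z.2)) (by fun_prop)
    have h3 : ∫⁻ ω, ∫⁻ z, S.indicator (1 : CountingMeasure X → ℝ≥0∞) (η ω + z) ∂κ ∂P = 0 := by
      rw [hη.lintegral_eq hB hG, ← h2]
      refine lintegral_congr fun ξ => ?_
      rw [lintegral_lintegral_swap (by fun_prop)]
      refine lintegral_congr fun ζ => lintegral_congr fun z => ?_
      rw [add_right_comm]
    filter_upwards [(lintegral_eq_zero_iff (hG.comp hη.measurable)).1 h3] with ω hω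
    have hm : Measurable fun z => S.indicator (1 : CountingMeasure X → ℝ≥0∞) (η ω + z) := by
      fun_prop
    have hω' : ∫⁻ z, S.indicator (1 : CountingMeasure X → ℝ≥0∞) (η ω + z) ∂κ = 0 := hω
    rw [show κ = (μ.restrict B).map single from rfl, lintegral_map hm measurable_single] at hω'
    filter_upwards [(lintegral_eq_zero_iff (hm.comp measurable_single)).1 hω'] with x hx
    intro hxS
    rw [addDirac_eq] at hxS
    simp [hxS] at hx
  filter_upwards [ae_all_iff.2 key] with ω hω
  rw [← Measure.restrict_univ (μ := μ), ← iUnion_spanningSets μ, ae_restrict_iUnion_iff]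
  exact hω

end IsPoissonProcess

/-! ### Truncation to compact subintervals of the positive half-line -/

section Truncation

lemma clamp_mem_Icc {e k x : ℝ} (h : e ≤ k) : clamp e k x ∈ Set.Icc e k :=
  ⟨le_max_left _ _, max_le h (min_le_right _ _)⟩

lemma measurable_clamp {α : Type*} [MeasurableSpace α] (e k : ℝ) {f : α → ℝ} (hf : Measurable f) :
    Measurable fun x => clamp e k (f x) := by
  unfold clamp; fun_prop

lemma tendsto_clamp {x : ℝ} (hx : 0 ≤ x) :
    Filter.Tendsto (fun n : ℕ => clamp (1 / ((n : ℝ) + 1)) ((n : ℝ) + 1) x) Filter.atTop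
      (nhds x) := by
  have h1 : Filter.Tendsto (fun n : ℕ => min x ((n : ℝ) + 1)) Filter.atTop (nhds x) := by
    refine tendsto_const_nhds.congr' ?_
    filter_upwards [Filter.eventually_ge_atTop ⌈x⌉₊] with n hn
    have := (Nat.le_ceil x).trans (Nat.cast_le.2 hn)
    rw [min_eq_left (by linarith)]
  have h2 := (tendsto_one_div_add_atTop_nhds_zero_nat (𝕜 := ℝ)).max h1
  rwa [max_eq_right hx] at h2

lemma one_div_le_self (n : ℕ) : 1 / ((n : ℝ) + 1) ≤ (n : ℝ) + 1 := by
  have : (0 : ℝ) ≤ n := n.cast_nonneg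
  rw [div_le_iff₀ (by positivity)]
  nlinarith

lemma norm_clamp_le {x : ℝ} (hx : 0 ≤ x) (n : ℕ) :
    ‖clamp (1 / ((n : ℝ) + 1)) ((n : ℝ) + 1) x‖ ≤ x + 1 := by
  have h0 : (0 : ℝ) < 1 / ((n : ℝ) + 1) := by positivity
  have h1 : 1 / ((n : ℝ) + 1) ≤ 1 := by
    rw [div_le_one (by positivity)]
    have : (0 : ℝ) ≤ n := n.cast_nonneg
    linarith
  unfold clamp
  rw [Real.norm_of_nonneg (h0.le.trans (le_max_left _ _))]
  exact max_le (by linarith) ((min_le_left _ _).trans (by linarith))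

end Truncation

/-! ### Nonnegative integrable functionals -/

namespace IsPoissonProcess
variable {X Ω : Type*} [MeasurableSpace X] [MeasurableSpace Ω] {μ : Measure X} [SigmaFinite μ]
  {P : Measure Ω} [IsProbabilityMeasure P] {η : Ω → CountingMeasure X} {f : CountingMeasure X → ℝ}

lemma ae_nonneg_addDirac (hη : IsPoissonProcess η μ P) (hf : Measurable f)
    (h0 : ∀ᵐ ω ∂P, 0 ≤ f (η ω)) : ∀ᵐ ω ∂P, ∀ᵐ x ∂μ, 0 ≤ f ((η ω).addDirac x) := by
  have h := hη.ae_addDirac (S := {ξ | f ξ < 0}) (measurableSet_lt hf measurable_const)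
    (h0.mono fun ω hω => not_lt.2 hω)
  exact h.mono fun ω hω => hω.mono fun x hx => not_lt.1 hx

/-- The entropy inequality for nonnegative integrable Poisson functionals. -/
theorem lintegral_rpow_le (hη : IsPoissonProcess η μ P) (hf : Measurable f)
    (hi : Integrable (fun ω => f (η ω)) P) (h0 : ∀ᵐ ω ∂P, 0 ≤ f (η ω)) {p : ℝ} (hp1 : 1 ≤ p)
    (hp2 : p ≤ 2) :
    ∫⁻ ω, ENNReal.ofReal (f (η ω) ^ p) ∂P ≤
      ENNReal.ofReal p * ∫⁻ ω, ∫⁻ x,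
        ENNReal.ofReal (powGap (p - 1) (f (η ω)) (f ((η ω).addDirac x))) ∂μ ∂P +
      ENNReal.ofReal ((∫ ω, f (η ω) ∂P) ^ p) := by
  have hp0 : 0 ≤ p := by linarith
  have hq0 : 0 ≤ p - 1 := by linarith
  set I := ∫⁻ ω, ∫⁻ x,
    ENNReal.ofReal (powGap (p - 1) (f (η ω)) (f ((η ω).addDirac x))) ∂μ ∂P
  let T : ℕ → ℝ → ℝ := fun n => clamp (1 / ((n : ℝ) + 1)) ((n : ℝ) + 1)
  have hTpos : ∀ n : ℕ, (0 : ℝ) < 1 / ((n : ℝ) + 1) := fun n => by positivity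
  have hTm : ∀ n, Measurable fun ξ => T n (f ξ) := fun n => measurable_clamp _ _ hf
  have hT : ∀ (n : ℕ) ξ, T n (f ξ) ∈ Set.Icc (1 / ((n : ℝ) + 1)) ((n : ℝ) + 1) := fun n ξ =>
    clamp_mem_Icc (one_div_le_self n)
  have hbound : ∀ n, ∫⁻ ω, ENNReal.ofReal (T n (f (η ω)) ^ p) ∂P ≤
      ENNReal.ofReal p * I + ENNReal.ofReal ((∫ ω, T n (f (η ω)) ∂P) ^ p) := by
    intro n
    have h := hη.ofReal_entropy_le_of_mem_Icc (hTm n) (hT n) (hTpos n) hp1 hp2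
    have hI : ∫⁻ ω, ∫⁻ x, ENNReal.ofReal (powGap (p - 1) (T n (f (η ω)))
        (T n (f ((η ω).addDirac x)))) ∂μ ∂P ≤ I := by
      refine lintegral_mono_ae ?_
      -- `powGap_clamp_le` needs nonnegativity at `η + δ_x` too, although `f` is only known to be
      -- nonnegative along `η`.
      filter_upwards [h0, hη.ae_nonneg_addDirac hf h0] with ω h1 h2
      refine lintegral_mono_ae ?_
      filter_upwards [h2] with x h3
      exact ENNReal.ofReal_le_ofReal
        (powGap_clamp_le (hTpos n).le (by positivity) h1 h3 hq0)
    have hpi : Integrable (fun ω => T n (f (η ω)) ^ p) P :=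
      integrable_of_mem_Icc (((hTm n).comp hη.measurable).pow_const p)
        fun ω => rpow_mem_Icc hp0 (hTpos n) (hT n (η ω))
    rw [← ofReal_integral_eq_lintegral_ofReal hpi (.of_forall fun ω =>
      Real.rpow_nonneg ((hTpos n).le.trans (hT n (η ω)).1) p)]
    calc _ ≤ ENNReal.ofReal (∫ ω, T n (f (η ω)) ^ p ∂P - (∫ ω, T n (f (η ω)) ∂P) ^ p) +
          ENNReal.ofReal ((∫ ω, T n (f (η ω)) ∂P) ^ p) := by
          refine le_trans (ENNReal.ofReal_le_ofReal (le_of_eq ?_)) ENNReal.ofReal_add_le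
          ring
      _ ≤ _ := add_le_add (h.trans (mul_le_mul_right hI _)) le_rfl
  have hmean : Filter.Tendsto (fun n => ∫ ω, T n (f (η ω)) ∂P) Filter.atTop
      (nhds (∫ ω, f (η ω) ∂P)) := by
    refine tendsto_integral_of_dominated_convergence (fun ω => f (η ω) + 1)
      (fun n => ((hTm n).comp hη.measurable).aestronglyMeasurable)
      (hi.add (integrable_const 1)) (fun n => ?_) ?_
    · exact h0.mono fun ω hω => norm_clamp_le hω n
    · exact h0.mono fun ω hω => tendsto_clamp hω
  have hlim : Filter.Tendsto (fun n => ENNReal.ofReal p * I +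
      ENNReal.ofReal ((∫ ω, T n (f (η ω)) ∂P) ^ p)) Filter.atTop
      (nhds (ENNReal.ofReal p * I + ENNReal.ofReal ((∫ ω, f (η ω) ∂P) ^ p))) :=
    tendsto_const_nhds.add (ENNReal.tendsto_ofReal (hmean.rpow_const (Or.inr hp0)))
  -- Fatou's lemma, since the `p`-th moment may be infinite; the means converge by dominated
  -- convergence.
  calc ∫⁻ ω, ENNReal.ofReal (f (η ω) ^ p) ∂P
      = ∫⁻ ω, Filter.liminf (fun n => ENNReal.ofReal (T n (f (η ω)) ^ p)) Filter.atTop ∂P := by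
        refine lintegral_congr_ae (h0.mono fun ω hω => ?_)
        exact (ENNReal.tendsto_ofReal
          ((tendsto_clamp hω).rpow_const (Or.inr hp0))).liminf_eq.symm
    _ ≤ Filter.liminf (fun n => ∫⁻ ω, ENNReal.ofReal (T n (f (η ω)) ^ p) ∂P) Filter.atTop :=
        lintegral_liminf_le fun n =>
          (((hTm n).comp hη.measurable).pow_const p).ennreal_ofReal
    _ ≤ Filter.liminf (fun n => ENNReal.ofReal p * I +
          ENNReal.ofReal ((∫ ω, T n (f (η ω)) ∂P) ^ p)) Filter.atTop :=
        Filter.liminf_le_liminf (.of_forall hbound)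
    _ = _ := hlim.liminf_eq

end IsPoissonProcess

/-! ### The entropy inequality in extended real form -/

theorem corollary2p4 {X Ω : Type*} [MeasurableSpace X] [MeasurableSpace Ω]
    (μ : Measure X) [SigmaFinite μ] (P : Measure Ω) [IsProbabilityMeasure P]
    (η : Ω → CountingMeasure X) (hη : IsPoissonProcess η μ P)
    (F : Ω → ℝ) (f : CountingMeasure X → ℝ) (hf : IsRepresentative f F η P)
    (hF_int : Integrable F P) (hF_nonneg : ∀ᵐ ω ∂P, 0 ≤ F ω)
    (r : ℝ) (hr : r ∈ Set.Ioo (1 : ℝ) 2) :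
    -- the integrand is almost everywhere nonnegative, so its integral is well defined in `[0, ∞]`
    (∀ᵐ ω ∂P, ∀ᵐ x ∂μ,
      0 ≤ diffOp f x (η ω) * diffOp (fun ξ => f ξ ^ (2 / r - 1)) x (η ω)) ∧
    phiEntropy P (powPhi r) F ≤
      ((ENNReal.ofReal (6 / r) * ∫⁻ ω, ∫⁻ x, ENNReal.ofReal
        (diffOp f x (η ω) * diffOp (fun ξ => f ξ ^ (2 / r - 1)) x (η ω)) ∂μ ∂P : ℝ≥0∞) : EReal) := by
  obtain ⟨hfm, hFf⟩ := hf
  have hr0 : 0 < r := by linarith [hr.1]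
  have hp1 : 1 ≤ 2 / r := by rw [le_div_iff₀ hr0]; linarith [hr.2]
  have hp2 : 2 / r ≤ 2 := by rw [div_le_iff₀ hr0]; linarith [hr.1]
  have h0 : ∀ᵐ ω ∂P, 0 ≤ f (η ω) := by
    filter_upwards [hFf, hF_nonneg] with ω h1 h2
    rwa [← h1]
  refine ⟨?_, ?_⟩
  · filter_upwards [h0, hη.ae_nonneg_addDirac hfm h0] with ω h1 h2
    filter_upwards [h2] with x h3
    exact powGap_nonneg (by linarith) h1 h3
  · have hmain := hη.lintegral_rpow_le hfm (hF_int.congr hFf) h0 hp1 hp2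
    rw [← integral_congr_ae hFf,
      ← lintegral_congr_ae (hFf.mono fun ω hω => by
        show ENNReal.ofReal (F ω ^ (2 / r)) = _; rw [hω])] at hmain
    have hneg : ∫⁻ ω, ENNReal.ofReal (-(powPhi r (F ω))) ∂P = 0 := by
      rw [← lintegral_zero (μ := P)]
      refine lintegral_congr_ae (hF_nonneg.mono fun ω hω => ?_)
      exact ENNReal.ofReal_of_nonpos (neg_nonpos.2 (Real.rpow_nonneg hω _))
    have hmean : 0 ≤ (∫ ω, F ω ∂P) ^ (2 / r) :=
      Real.rpow_nonneg (integral_nonneg_of_ae hF_nonneg) _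
    unfold phiEntropy extExpectation
    -- The subtracted power of the mean is finite, so it can be moved to the other side even when
    -- the entropy is infinite.
    rw [hneg, EReal.coe_ennreal_zero, sub_zero,
      EReal.sub_le_iff_le_add (Or.inl (EReal.coe_ne_bot _)) (Or.inl (EReal.coe_ne_top _))]
    have hcoe : ((powPhi r (∫ ω, F ω ∂P) : ℝ) : EReal) =
        ((ENNReal.ofReal ((∫ ω, F ω ∂P) ^ (2 / r)) : ℝ≥0∞) : EReal) := by
      rw [EReal.coe_ennreal_ofReal, max_eq_left hmean]; rfl
    rw [hcoe, ← EReal.coe_ennreal_add, EReal.coe_ennreal_le_coe_ennreal_iff]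
    -- What is left is `2 / r ≤ 6 / r`.
    refine hmain.trans (add_le_add (mul_le_mul_left (ENNReal.ofReal_le_ofReal ?_) _) le_rfl)
    gcongr
    norm_num
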